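/- Let $N\ge 1$ be an integer, $W>0$, $z,\zeta\in\mathbb C$ with $|z|<1$, and $$z_1=z+\zeta/\sqrt N,\qquad z_2=z-\zeta/\sqrt N .$$ Let $\Delta$ be the discrete Laplacian on $\{1,\dots,N\}$ with Neumann boundary conditions, i.e. $(-\Delta f)_j=\sum_{k\in\{j-1,j+1\}\cap\{1,\dots,N\}}(f_j-f_k)$, and let $J=(-W^2\Delta+1)^{-1}$. Let $H=(H_{jk})_{j,k=1}^N$ be the random matrix whose entries are independent centred complex Gaussian variables with $\mathbf E|H_{jk}|^2=J_{jk}$, that is, with law $$P_N(dH)=\prod_{j,k=1}^N\frac{dH_{jk}\,d\overline H_{jk}}{\pi J_{jk}}\,e^{-|H_{jk}|^2/J_{jk}},$$ where $dw\,d\bar w$ denotes the Lebesgue measure on $\mathbb C$. Put $$\Theta(z_1,z_2)=\mathbf E\Big\{\prod_{s=1}^2\det(H-z_s)\det(H-z_s)^*\Big\},\qquad \tilde\Theta(z_1,z_2)=(\pi^2W^2\lambda_*^{-1})^{2(N-1)}\,C_{N,W}^{-1}\,\Theta(z_1,z_2),$$ $$u_*=(1-|z|^2)^{1/2},\quad \alpha=u_*(2+u_*^2W^{-2})^{1/2},\quad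 \lambda_*=1-W^{-1}(\alpha-u_*^2W^{-1}),\quad C_{N,W}=e^{-2Nu_*^2}\,\pi^{-4N}\,(\det J)^{-4}.$$ Let $H_2$ be the space of $2\times2$ complex matrices with Lebesgue measure $dQ=\prod_{p,r=1}^2d\overline Q_{pr}\,dQ_{pr}$, and for $Q\in H_2$ let $$\mathcal Q=\begin{pmatrix}\hat z&iQ\\ iQ^*&\hat z^*\end{pmatrix},\quad \hat z=\mathrm{diag}\{z_1,z_2\},\qquad f(Q)=\tfrac12\big(-\mathrm{Tr}\,QQ^*+\log\det\mathcal Q+2u_*^2\big),\qquad g(Q)=e^{f(Q)},$$ with the principal branch of $\log$ and with $e^{f(Q)}=0$ where $\det\mathcal Q=0$. Let $$\mathcal K_\zeta(Q,Q')=\pi^4W^4\lambda_*^{-2}\exp\big\{-W^2\,\mathrm{Tr}\,(Q-Q')(Q-Q')^*+f(Q)+f(Q')\big\}.$$ Then $P_N$ is a probability measure, the expectation defining $\Theta(z_1,z_2)$ converges absolutely, $g\in L_2(H_2)$, and $\mathcal K_\zeta(Q,Q')$ is the kernel of a bounded integral operator $\mathcal K_\zeta:L_2(H_2)\to L_2(H_2)$.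 Moreover $$\tilde\Theta(z_1,z_2)=\int_{(H_2)^N}e^{f(Q_1)}\Big(\prod_{j=1}^{N-1}\mathcal K_\zeta(Q_j,Q_{j+1})\Big)e^{f(Q_N)}\prod_{j=1}^NdQ_j=(\mathcal K_\zeta^{N-1}g,g),$$ where the integral converges absolutely and $(u,v)=\int_{H_2}u(Q)\,v(Q)\,dQ$ is the bilinear pairing. If $z_1\bar z_2$ is real and nonnegative, then the last equality also holds with $(\cdot,\cdot)$ the (sesquilinear) inner product of $L_2(H_2)$. -/

import Mathlib

open MeasureTheory
open scoped Matrix ComplexConjugate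

noncomputable section

namespace BandMatrix

/-! ### The band profile and the random matrix -/

/-- The matrix of `-Δ`, the negative discrete Laplacian on `{1, …, N}` with Neumann boundary
conditions: `(-Δ f)_j` is the sum of `f_j - f_k` over the neighbours `k = j ± 1` of `j` that lie in
`{1, …, N}`. (Indices are shifted to `0, …, N - 1`; for `N = 1` this is zero.) -/
def negLaplacian (N : ℕ) : Matrix (Fin N) (Fin N) ℝ := Matrix.of fun j k =>
  (if j = k then (if 0 < (j : ℕ) then 1 else 0) + (if (j : ℕ) + 1 < N then 1 else 0) else 0)
    - (if (j : ℕ) + 1 = k ∨ (k : ℕ) + 1 = j then 1 else 0)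

/-- The band profile `J = (-W²Δ + 1)⁻¹`. -/
def profile (N : ℕ) (W : ℝ) : Matrix (Fin N) (Fin N) ℝ :=
  (W ^ 2 • negLaplacian N + 1)⁻¹

/-- The law `P_N(dH) = ∏_{j,k} (π J_{jk})⁻¹ exp(-|H_{jk}|² / J_{jk}) dH_{jk} dH̄_{jk}` of the band
matrix, where `dH_{jk} dH̄_{jk}` is the Lebesgue measure on `ℂ`. -/
def law (N : ℕ) (W : ℝ) : Measure (Fin N → Fin N → ℂ) :=
  (volume : Measure (Fin N → Fin N → ℂ)).withDensity fun H =>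
    ENNReal.ofReal (∏ j, ∏ k,
      (Real.pi * profile N W j k)⁻¹ * Real.exp (-‖H j k‖ ^ 2 / profile N W j k))

/-- `det (H - w) · det (H - w)^*`. -/
def charProd {N : ℕ} (w : ℂ) (H : Fin N → Fin N → ℂ) : ℂ :=
  (Matrix.of H - w • (1 : Matrix (Fin N) (Fin N) ℂ)).det *
    (Matrix.of H - w • (1 : Matrix (Fin N) (Fin N) ℂ))ᴴ.det

/-- The second correlation function of characteristic polynomials,
`Θ(z₁, z₂) = E { det(H - z₁) det(H - z₁)^* det(H - z₂) det(H - z₂)^* }`. -/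
def Theta (N : ℕ) (W : ℝ) (z₁ z₂ : ℂ) : ℂ :=
  ∫ H, charProd z₁ H * charProd z₂ H ∂(law N W)

/-! ### Normalization -/

/-- `u_* = (1 - |z|²)^{1/2}`. -/
def uStar (z : ℂ) : ℝ := Real.sqrt (1 - ‖z‖ ^ 2)

/-- `α = u_* (2 + u_*² W⁻²)^{1/2}`. -/
def alpha (W : ℝ) (z : ℂ) : ℝ := uStar z * Real.sqrt (2 + uStar z ^ 2 * (W ^ 2)⁻¹)

/-- `λ_* = 1 - W⁻¹ (α - u_*² W⁻¹)`. -/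
def lambdaStar (W : ℝ) (z : ℂ) : ℝ := 1 - W⁻¹ * (alpha W z - uStar z ^ 2 * W⁻¹)

/-- `C_{N,W} = e^{-2 N u_*²} π^{-4N} det^{-4} J`. -/
def normConst (N : ℕ) (W : ℝ) (z : ℂ) : ℝ :=
  Real.exp (-2 * N * uStar z ^ 2) * ((Real.pi ^ (4 * N))⁻¹ * ((profile N W).det ^ 4)⁻¹)

/-- `z₁ = z + ζ / N^{1/2}`. -/
def zOne (N : ℕ) (z ζ : ℂ) : ℂ := z + ζ / (Real.sqrt N : ℂ)

/-- `z₂ = z - ζ / N^{1/2}`. -/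
def zTwo (N : ℕ) (z ζ : ℂ) : ℂ := z - ζ / (Real.sqrt N : ℂ)

/-- The normalized correlation function
`Θ̃(z₁, z₂) = (π² W² λ_*⁻¹)^{2(N-1)} C_{N,W}⁻¹ Θ(z₁, z₂)` at `z₁ = z + ζ/√N`, `z₂ = z - ζ/√N`. -/
def ThetaTilde (N : ℕ) (W : ℝ) (z ζ : ℂ) : ℂ :=
  (((Real.pi ^ 2 * W ^ 2 * (lambdaStar W z)⁻¹) ^ (2 * (N - 1)) * (normConst N W z)⁻¹ : ℝ) : ℂ) *
    Theta N W (zOne N z ζ) (zTwo N z ζ)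

/-! ### The transfer operator -/

/-- The space `H₂` of `2 × 2` complex matrices, as the space of their entries, with the Lebesgue
measure `volume = ∏_{p,r} dQ̄_{pr} dQ_{pr}`. Matrix operations go through `Matrix.of`. -/
abbrev Mat2 : Type := Fin 2 → Fin 2 → ℂ

/-- `Tr A A^*`, which is the real number `∑ |A_{pr}|²`. -/
def trSq (A : Mat2) : ℝ := ((Matrix.of A) * (Matrix.of A)ᴴ).trace.re

/-- The `4 × 4` matrix with blocks `ẑ`, `iQ`, `iQ^*`, `ẑ^*`, where `ẑ = diag(z₁, z₂)`. -/
def calQ (z₁ z₂ : ℂ) (Q : Mat2) : Matrix (Fin 2 ⊕ Fin 2) (Fin 2 ⊕ Fin 2) ℂ :=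
  Matrix.fromBlocks (Matrix.diagonal ![z₁, z₂]) (Complex.I • Matrix.of Q)
    (Complex.I • (Matrix.of Q)ᴴ) (Matrix.diagonal ![z₁, z₂])ᴴ

/-- `f(Q) = ½ (-Tr QQ^* + log det 𝒬 + 2 u_*²)`, with the principal branch of the logarithm; it is
meaningful only where `det 𝒬 ≠ 0`. -/
def f (N : ℕ) (z ζ : ℂ) (Q : Mat2) : ℂ :=
  (1 / 2 : ℂ) * (-(trSq Q : ℂ) + Complex.log (calQ (zOne N z ζ) (zTwo N z ζ) Q).det
    + 2 * (uStar z : ℂ) ^ 2)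

/-- `g = e^f`, with the convention `e^{log 0} = 0` on the null set where `det 𝒬 = 0` (where
`Complex.log 0 = 0` would be meaningless). -/
def g (N : ℕ) (z ζ : ℂ) (Q : Mat2) : ℂ :=
  if (calQ (zOne N z ζ) (zTwo N z ζ) Q).det = 0 then 0 else Complex.exp (f N z ζ Q)

/-- The kernel `π⁴ W⁴ λ_*⁻² exp{-W² Tr (Q - Q')(Q - Q')^* + f(Q) + f(Q')}`; the factors `e^{f(Q)}`,
`e^{f(Q')}` are written as `g Q`, `g Q'`. -/
def kernel (N : ℕ) (W : ℝ) (z ζ : ℂ) (Q Q' : Mat2) : ℂ :=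
  ((Real.pi ^ 4 * W ^ 4 * (lambdaStar W z ^ 2)⁻¹ * Real.exp (-W ^ 2 * trSq (Q - Q')) : ℝ) : ℂ) *
    (g N z ζ Q * g N z ζ Q')

/-- The Hilbert space `L₂(H₂)`. -/
abbrev L2Mat2 : Type := Lp ℂ 2 (volume : Measure Mat2)

/-- `T` is the integral operator on `L₂(H₂)` with kernel `k`: for every `u`, the integral
`∫ k(Q, Q') u(Q') dQ'` converges absolutely for almost every `Q` and is equal to `(T u)(Q)`. -/
def IsIntegralOperator (T : L2Mat2 →L[ℂ] L2Mat2) (k : Mat2 → Mat2 → ℂ) : Prop :=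
  ∀ u : L2Mat2,
    (∀ᵐ Q : Mat2, Integrable fun Q' : Mat2 => k Q Q' * u Q') ∧
      ∀ᵐ Q : Mat2, (T u) Q = ∫ Q' : Mat2, k Q Q' * u Q'

/-- The integrand `e^{f(Q₁)} (∏_{j=1}^{N-1} 𝒦(Q_j, Q_{j+1})) e^{f(Q_N)}` on `(H₂)^N` (indices are
shifted to `0, …, N - 1`). -/
def chainIntegrand (N : ℕ) (hN : 0 < N) (W : ℝ) (z ζ : ℂ) (Q : Fin N → Mat2) : ℂ :=
  g N z ζ (Q ⟨0, hN⟩) *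
    (∏ j : Fin (N - 1),
      kernel N W z ζ (Q ⟨j, by have := j.isLt; omega⟩) (Q ⟨j + 1, by have := j.isLt; omega⟩)) *
    g N z ζ (Q ⟨N - 1, by omega⟩)

end BandMatrix

end

noncomputable section

namespace BandMatrix

/-! ### A commutative algebra of second differences of the determinant -/

section DetAlgebra

/-! The theorem rests on a Hubbard–Stratonovich duality. The product of the four determinants is a
single determinant of size `4N`, affine in `H` and its conjugate. Written as a Berezin integral and
averaged over `H`, it gives an exponential quartic in Grassmann variables. Reordering each quartic
term decouples it through a Gaussian field `Q` with one `2 × 2` matrix per site and precision `-W²Δ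
+ 1`. The determinant then splits into one factor `det 𝒬` per site.

Only even bilinears of Grassmann variables occur, so a commutative algebra replaces them. In
`DetAlgebra` the element `detUnit a b` plays the role of `ψ̄_a ψ_b`: it obeys `detUnit_mul_swap` and
`detUnit_sq`, and `detEval` acts as the Berezin integral by `detEval_exp_detVec`. Gaussian averages
of determinants then depend only on a quadratic expression in this algebra
(`HasGaussianMoments.integral_det`). The duality is the equality of two such expressions,
`wick_exponent_eq`; `det_band` and `det_dual` identify the two determinants.

To reach the chain, factor the precision as `BᵀB` and substitute `G = BQ` (`integral_siteMap`). The
Gaussian weight becomes a Dirichlet form (`quadForm_precision`), that is, a product of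
nearest-neighbour factors. Each site carries `g` exactly twice in the chain, and `g_sq` turns the
square into `det 𝒬`, so the branch of the logarithm plays no role. This gives
`thetaTilde_eq_integral`.

The operator statement needs only the bound of the kernel by a constant times `|g(Q)| |g(Q')|` with
`g` square integrable. It yields boundedness by Cauchy–Schwarz (`exists_integralOperator`) and
absolute convergence of the chain, and Fubini identifies the chain with the iterated operator
(`integral_pow_toLp_mul`). -/

theorem det_add_single {n : Type*} [Fintype n] [DecidableEq n] (M : Matrix n n ℂ) (a b : n)
    (x : ℂ) :
    (M + Matrix.single a b x).det = M.det + x * (M.updateRow a (Pi.single b 1)).det := by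
  have : M + Matrix.single a b x = M.updateRow a (M a + x • Pi.single b 1) := by
    ext i j
    by_cases hi : i = a
    · subst hi
      by_cases hj : j = b
      · subst hj; simp
      · simp [hj, Ne.symm hj]
    · simp [hi, Ne.symm hi]
  rw [this, Matrix.det_updateRow_add, Matrix.det_updateRow_smul, Matrix.updateRow_eq_self]

theorem det_updateRow_updateRow_swap {n : Type*} [Fintype n] [DecidableEq n] (M : Matrix n n ℂ)
    {a c : n} (h : a ≠ c) (x y : n → ℂ) :
    ((M.updateRow a x).updateRow c y).det = -((M.updateRow a y).updateRow c x).det := by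
  have : (M.updateRow a y).updateRow c x =
      ((M.updateRow a x).updateRow c y).submatrix (Equiv.swap a c) id := by
    ext i j
    by_cases hi : i = a
    · subst hi; simp [h]
    · by_cases hc : i = c
      · subst hc; simp [h]
      · simp [Equiv.swap_apply_of_ne_of_ne hi hc, hi, hc]
  rw [this, Matrix.det_permute, Equiv.Perm.sign_swap h]
  simp

variable (n : Type*) [Fintype n] [DecidableEq n]

/-- The linear functional `[M] ↦ det M` on the group algebra of the additive group of matrices. -/
def detFunctional : AddMonoidAlgebra ℂ (Matrix n n ℂ) →ₗ[ℂ] ℂ :=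
  (Finsupp.lsum ℂ fun M : Matrix n n ℂ => LinearMap.toSpanSingleton ℂ ℂ M.det) ∘ₗ
    (AddMonoidAlgebra.coeffLinearEquiv ℂ).toLinearMap

/-- The largest ideal on which `detFunctional` vanishes. -/
def detIdeal : Ideal (AddMonoidAlgebra ℂ (Matrix n n ℂ)) where
  carrier := {x | ∀ y, detFunctional n (y * x) = 0}
  zero_mem' := by simp
  add_mem' := by
    intro a b ha hb y
    rw [mul_add, map_add, ha y, hb y, add_zero]
  smul_mem' := by
    intro c x hx y
    rw [smul_eq_mul, ← mul_assoc]
    exact hx _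

/-- The quotient of the group algebra of matrices by `detIdeal`. -/
abbrev DetAlgebra : Type _ := AddMonoidAlgebra ℂ (Matrix n n ℂ) ⧸ detIdeal n

/-- The functional induced by `detFunctional` on `DetAlgebra`. -/
def detEval : DetAlgebra n →ₗ[ℂ] ℂ :=
  ((detIdeal n).restrictScalars ℂ).liftQ (detFunctional n) (by
    intro x hx
    have := hx 1
    rwa [one_mul] at this)

variable {n}

theorem detFunctional_single (M : Matrix n n ℂ) (c : ℂ) :
    detFunctional n (AddMonoidAlgebra.single M c) = c * M.det := by
  simp [detFunctional]

theorem detEval_mk (x : AddMonoidAlgebra ℂ (Matrix n n ℂ)) :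
    detEval n (Ideal.Quotient.mk (detIdeal n) x) = detFunctional n x := rfl

/-- The elements `[M]` span the group algebra, so by linearity they suffice as multipliers. -/
theorem mem_detIdeal {x : AddMonoidAlgebra ℂ (Matrix n n ℂ)}
    (h : ∀ M : Matrix n n ℂ, detFunctional n (AddMonoidAlgebra.single M 1 * x) = 0) :
    x ∈ detIdeal n := by
  intro y
  induction y using AddMonoidAlgebra.induction_linear with
  | zero => simp
  | add a b ha hb => rw [add_mul, map_add, ha, hb, add_zero]
  | single M r =>
    have : AddMonoidAlgebra.single M r = r • AddMonoidAlgebra.single M (1 : ℂ) := by simp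
    rw [this, smul_mul_assoc, map_smul, h, smul_zero]

/-- The difference operator in the entry `(a, b)`. -/
def entryDiff (a b : n) : AddMonoidAlgebra ℂ (Matrix n n ℂ) :=
  AddMonoidAlgebra.single (Matrix.single a b 1) 1 - 1

theorem detFunctional_single_mul_entryDiff (M : Matrix n n ℂ) (a b : n) :
    detFunctional n (AddMonoidAlgebra.single M 1 * entryDiff a b) =
      (M.updateRow a (Pi.single b 1)).det := by
  simp only [entryDiff, mul_sub, AddMonoidAlgebra.single_mul_single, mul_one, map_sub,
    detFunctional_single, one_mul, det_add_single]
  ring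

/-- A first difference in row `a` replaces that row by a basis vector, so a further difference in
the same row vanishes. In distinct rows both get replaced. -/
theorem detFunctional_single_mul_entryDiff_mul (M : Matrix n n ℂ) (a b c d : n) :
    detFunctional n (AddMonoidAlgebra.single M 1 * (entryDiff a b * entryDiff c d)) =
      if a = c then 0 else ((M.updateRow a (Pi.single b 1)).updateRow c (Pi.single d 1)).det := by
  rw [mul_comm (entryDiff a b), ← mul_assoc]
  conv_lhs => rw [entryDiff, mul_sub, mul_one, AddMonoidAlgebra.single_mul_single, one_mul]
  rw [sub_mul, map_sub, detFunctional_single_mul_entryDiff, detFunctional_single_mul_entryDiff]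
  split_ifs with h
  · subst h
    rw [sub_eq_zero]
    congr 1
    ext i j
    by_cases hi : i = a
    · subst hi; simp
    · simp [hi, Ne.symm hi]
  · have : (M + Matrix.single c d 1).updateRow a (Pi.single b 1) =
        M.updateRow a (Pi.single b 1) + Matrix.single c d 1 := by
      ext i j
      by_cases hi : i = a
      · subst hi; simp [Ne.symm h]
      · simp [hi]
    rw [this, det_add_single]
    ring

/-- Exchanging the two replaced rows flips the sign of the determinant. This is the anticommutation
rule that the duality uses. -/
theorem entryDiff_mul_add_swap_mem (a b c d : n) :
    entryDiff a b * entryDiff c d + entryDiff a d * entryDiff c b ∈ detIdeal n := by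
  refine mem_detIdeal fun M => ?_
  rw [mul_add, map_add, detFunctional_single_mul_entryDiff_mul,
    detFunctional_single_mul_entryDiff_mul]
  split_ifs with h
  · simp
  · rw [det_updateRow_updateRow_swap M h]
    ring

/-- The image of the matrix unit `(a, b)` in `DetAlgebra`. -/
def detUnit (a b : n) : DetAlgebra n := Ideal.Quotient.mk (detIdeal n) (entryDiff a b)

theorem detUnit_mul_swap (a b c d : n) :
    detUnit a b * detUnit c d = -(detUnit a d * detUnit c b) := by
  rw [eq_neg_iff_add_eq_zero]
  simp only [detUnit, ← map_mul, ← map_add]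
  exact Ideal.Quotient.eq_zero_iff_mem.2 (entryDiff_mul_add_swap_mem a b c d)

theorem detUnit_sq (a b : n) : detUnit a b ^ 2 = 0 := by
  simp only [detUnit, ← map_pow]
  refine Ideal.Quotient.eq_zero_iff_mem.2 (mem_detIdeal fun M => ?_)
  rw [sq, detFunctional_single_mul_entryDiff_mul, if_pos rfl]

/-- The element of `DetAlgebra` attached to a matrix, `∑ X_{ab} e_{ab}`. -/
def detVec : Matrix n n ℂ →ₗ[ℂ] DetAlgebra n where
  toFun X := ∑ p : n × n, X p.1 p.2 • detUnit p.1 p.2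
  map_add' X Y := by simp [add_smul, Finset.sum_add_distrib]
  map_smul' c X := by simp [mul_smul, Finset.smul_sum]

theorem detVec_apply (X : Matrix n n ℂ) :
    detVec X = ∑ p : n × n, X p.1 p.2 • detUnit p.1 p.2 := rfl

theorem detVec_single (a b : n) (x : ℂ) : detVec (Matrix.single a b x) = x • detUnit a b := by
  rw [detVec_apply, Finset.sum_eq_single (a, b)]
  · simp
  · rintro ⟨c, d⟩ - h
    have : ¬ (a = c ∧ b = d) := fun h' => h (by simp [h'.1, h'.2])
    simp [this]
  · simp

theorem isNilpotent_detVec (X : Matrix n n ℂ) : IsNilpotent (detVec X) := by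
  rw [detVec_apply]
  exact isNilpotent_sum fun p _ => IsNilpotent.smul ⟨2, detUnit_sq _ _⟩ _

theorem isNilpotent_exp_sum {R : Type*} [CommRing R] [Algebra ℚ R] {ι : Type*} (s : Finset ι)
    (f : ι → R) (hf : ∀ i ∈ s, IsNilpotent (f i)) :
    IsNilpotent.exp (∑ i ∈ s, f i) = ∏ i ∈ s, IsNilpotent.exp (f i) := by
  classical
  induction s using Finset.induction_on with
  | empty => simp [IsNilpotent.exp_zero]
  | insert a s ha ih =>
    rw [Finset.sum_insert ha, Finset.prod_insert ha,
      IsNilpotent.exp_add_of_commute (Commute.all _ _) (hf a (by simp))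
        (isNilpotent_sum fun i hi => hf i (by simp [hi])),
      ih fun i hi => hf i (by simp [hi])]

/-- The determinant is affine in each entry, so under `detFunctional` the factor `1 + x • entryDiff
a b` acts as the translation by `x` in the entry `(a, b)`, for every complex `x`. -/
theorem detFunctional_single_mul_prod (X M : Matrix n n ℂ) (s : Finset (n × n)) :
    detFunctional n (AddMonoidAlgebra.single M 1 *
      ∏ p ∈ s, (1 + X p.1 p.2 • entryDiff p.1 p.2)) =
      (M + ∑ p ∈ s, Matrix.single p.1 p.2 (X p.1 p.2)).det := by
  induction s using Finset.induction_on generalizing M with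
  | empty => simp [detFunctional_single]
  | insert p s hp ih =>
    have h : AddMonoidAlgebra.single M (1 : ℂ) *
        ((1 + X p.1 p.2 • entryDiff p.1 p.2) * ∏ p ∈ s, (1 + X p.1 p.2 • entryDiff p.1 p.2)) =
        (1 - X p.1 p.2) • (AddMonoidAlgebra.single M (1 : ℂ) *
          ∏ p ∈ s, (1 + X p.1 p.2 • entryDiff p.1 p.2)) +
        X p.1 p.2 • (AddMonoidAlgebra.single (M + Matrix.single p.1 p.2 1) (1 : ℂ) *
          ∏ p ∈ s, (1 + X p.1 p.2 • entryDiff p.1 p.2)) := by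
      have h' : AddMonoidAlgebra.single (M + Matrix.single p.1 p.2 1) (1 : ℂ) =
          AddMonoidAlgebra.single M 1 * AddMonoidAlgebra.single (Matrix.single p.1 p.2 1) 1 := by
        simp [AddMonoidAlgebra.single_mul_single]
      rw [h']
      generalize ∏ p ∈ s, (1 + X p.1 p.2 • entryDiff p.1 p.2) = Y
      simp only [entryDiff, Algebra.smul_def, map_sub, map_one]
      ring
    rw [Finset.prod_insert hp, Finset.sum_insert hp, h, map_add, map_smul, map_smul, ih, ih]
    rw [add_right_comm M, det_add_single, ← add_assoc, add_right_comm M, det_add_single]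
    simp only [smul_eq_mul]
    ring

/-- The determinant is an exponential generating function in `DetAlgebra`. -/
theorem detEval_exp_detVec (X : Matrix n n ℂ) :
    detEval n (IsNilpotent.exp (detVec X)) = X.det := by
  have h1 : ∀ p : n × n, IsNilpotent.exp (X p.1 p.2 • detUnit p.1 p.2) =
      Ideal.Quotient.mk (detIdeal n) (1 + X p.1 p.2 • entryDiff p.1 p.2) := by
    intro p
    rw [IsNilpotent.exp_eq_sum (k := 2) (by rw [smul_pow, detUnit_sq, smul_zero])]
    simp only [Finset.sum_range_succ, Finset.sum_range_zero, zero_add, pow_zero, pow_one,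
      Nat.factorial_zero, Nat.factorial_one, Nat.cast_one, inv_one, one_smul, map_add, map_one]
    rfl
  rw [detVec_apply, isNilpotent_exp_sum _ _ fun p _ => IsNilpotent.smul ⟨2, detUnit_sq _ _⟩ _]
  simp only [h1]
  rw [← map_prod, detEval_mk, ← one_mul (∏ p : n × n, _)]
  -- The unit of the group algebra is the zero matrix; the entries of `X` are then added to it one
  -- by one.
  rw [show (1 : AddMonoidAlgebra ℂ (Matrix n n ℂ)) = AddMonoidAlgebra.single 0 1 from rfl]
  have := detFunctional_single_mul_prod X 0 Finset.univ
  refine this.trans ?_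
  congr 1
  rw [zero_add, Fintype.sum_prod_type]
  exact (Matrix.matrix_eq_sum_single X).symm

end DetAlgebra

/-! ### Moments of complex Gaussian weights -/

theorem integral_norm_pow_mul_exp {c : ℝ} (hc : 0 < c) (a : ℕ) :
    ∫ x : ℂ, ‖x‖ ^ (2 * a) * Real.exp (-‖x‖ ^ 2 / c) = Real.pi * c * (a.factorial * c ^ a) := by
  have h := Complex.integral_rpow_mul_exp_neg_mul_rpow (p := 2) (q := ((2 * a : ℕ) : ℝ)) (b := c⁻¹)
    (by norm_num) (by have : (0 : ℝ) ≤ ((2 * a : ℕ) : ℝ) := by positivity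
                      linarith) (inv_pos.2 hc)
  have e1 : (((2 * a : ℕ) : ℝ) + 2) / 2 = a + 1 := by push_cast; ring
  have e2 : -(((2 * a : ℕ) : ℝ) + 2) / 2 = -((a + 1 : ℕ) : ℝ) := by push_cast; ring
  rw [e1, e2, Real.Gamma_nat_eq_factorial, Real.rpow_neg (inv_pos.2 hc).le, Real.rpow_natCast,
    inv_pow, inv_inv] at h
  rw [show (fun x : ℂ => ‖x‖ ^ (2 * a) * Real.exp (-‖x‖ ^ 2 / c)) =
    fun x : ℂ => ‖x‖ ^ ((2 * a : ℕ) : ℝ) * Real.exp (-c⁻¹ * ‖x‖ ^ (2 : ℝ)) from ?_, h]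
  · ring
  · ext x
    rw [Real.rpow_natCast, Real.rpow_two]
    congr 2
    field_simp

theorem integrable_norm_pow_mul_exp {c : ℝ} (hc : 0 < c) (a : ℕ) :
    Integrable fun x : ℂ => ‖x‖ ^ a * Real.exp (-‖x‖ ^ 2 / c) := by
  have h : ∀ a, Integrable fun x : ℂ => ‖x‖ ^ (2 * a) * Real.exp (-‖x‖ ^ 2 / c) := by
    intro a
    -- A nonzero Bochner integral already forces integrability.
    refine Integrable.of_integral_ne_zero ?_
    rw [integral_norm_pow_mul_exp hc]
    positivity
  refine ((h 0).add (h a)).mono' (by fun_prop) (Filter.Eventually.of_forall fun x => ?_)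
  rw [Real.norm_of_nonneg (by positivity), Pi.add_apply, ← add_mul]
  refine mul_le_mul_of_nonneg_right ?_ (Real.exp_pos _).le
  rw [mul_zero, pow_zero, mul_comm, pow_mul]
  have : 0 ≤ ‖x‖ ^ a := by positivity
  nlinarith [sq_nonneg (‖x‖ ^ a - 1)]

theorem integrable_moment {c : ℝ} (hc : 0 < c) (a b : ℕ) :
    Integrable fun x : ℂ => (x ^ a * conj x ^ b) * (Real.exp (-‖x‖ ^ 2 / c) : ℂ) := by
  refine (integrable_norm_pow_mul_exp hc (a + b)).mono' (by fun_prop)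
    (Filter.Eventually.of_forall fun x => ?_)
  rw [norm_mul, norm_mul, norm_pow, norm_pow, RCLike.norm_conj, ← pow_add, Complex.norm_real,
    Real.norm_of_nonneg (Real.exp_pos _).le]

theorem integral_moment {c : ℝ} (hc : 0 < c) (a b : ℕ) :
    ∫ x : ℂ, (x ^ a * conj x ^ b) * (Real.exp (-‖x‖ ^ 2 / c) : ℂ) =
      Real.pi * c * if a = b then (a.factorial * c ^ a : ℂ) else 0 := by
  split_ifs with h
  · subst h
    have : (fun x : ℂ => (x ^ a * conj x ^ a) * (Real.exp (-‖x‖ ^ 2 / c) : ℂ)) =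
        fun x : ℂ => ((‖x‖ ^ (2 * a) * Real.exp (-‖x‖ ^ 2 / c) : ℝ) : ℂ) := by
      ext x
      rw [← mul_pow, Complex.mul_conj, Complex.normSq_eq_norm_sq]
      push_cast
      ring
    rw [this, integral_complex_ofReal, integral_norm_pow_mul_exp hc]
    push_cast
    ring
  · have hab : (a : ℝ) - b ≠ 0 := sub_ne_zero.2 (by exact_mod_cast h)
    -- The angle is chosen so that the rotation multiplies `x ^ a * conj x ^ b` by `-1`; rotation
    -- invariance then makes the integral its own negative.
    let t : ℝ := Real.pi / (a - b)
    let u : Circle := Circle.exp t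
    have hu : (u : ℂ) ^ a * conj (u : ℂ) ^ b = -1 := by
      rw [Circle.coe_exp, ← Complex.exp_conj, ← Complex.exp_nat_mul, ← Complex.exp_nat_mul,
        ← Complex.exp_add, ← Complex.exp_pi_mul_I]
      congr 1
      have : (a : ℂ) - b ≠ 0 := by exact_mod_cast hab
      simp only [t, map_mul, Complex.conj_ofReal, Complex.conj_I]
      push_cast
      field_simp
      ring
    have key := (rotation u).measurePreserving.integral_comp
      (rotation u).toHomeomorph.measurableEmbedding
      (fun x : ℂ => (x ^ a * conj x ^ b) * (Real.exp (-‖x‖ ^ 2 / c) : ℂ))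
    have e : ∀ x : ℂ, ((rotation u) x ^ a * conj ((rotation u) x) ^ b) *
        (Real.exp (-‖(rotation u) x‖ ^ 2 / c) : ℂ) =
        -1 * ((x ^ a * conj x ^ b) * (Real.exp (-‖x‖ ^ 2 / c) : ℂ)) := by
      intro x
      rw [LinearIsometryEquiv.norm_map, rotation_apply, map_mul, mul_pow, mul_pow, ← hu]
      ring
    simp only [e] at key
    rw [integral_const_mul] at key
    rw [mul_zero]
    linear_combination (-1 / 2 : ℂ) * key

/-- The functions `h i` have, with respect to the weight `w`, the moments of independent centred
complex Gaussian variables with variances `c i` and total mass `Z`. -/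
def HasGaussianMoments {Ω ι : Type*} [Fintype ι] [MeasurableSpace Ω] (μ : Measure Ω) (w : Ω → ℂ)
    (h : ι → Ω → ℂ) (c : ι → ℂ) (Z : ℂ) : Prop :=
  ∀ m n : ι → ℕ, Integrable (fun ω => (∏ i, (h i ω ^ m i * conj (h i ω) ^ n i)) * w ω) μ ∧
    ∫ ω, (∏ i, (h i ω ^ m i * conj (h i ω) ^ n i)) * w ω ∂μ =
      Z * ∏ i, if m i = n i then ((m i).factorial * c i ^ m i : ℂ) else 0

/-- The index type `Unit` lets `HasGaussianMoments.pi` be iterated from here; it is the source of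
the trailing `Unit` in later index types. -/
theorem hasGaussianMoments_complex {c : ℝ} (hc : 0 < c) :
    HasGaussianMoments volume (fun x : ℂ => (Real.exp (-‖x‖ ^ 2 / c) : ℂ))
      (fun (_ : Unit) x => x) (fun _ => c) (Real.pi * c) := by
  intro m n
  simp only [Finset.univ_unique, Finset.prod_singleton]
  exact ⟨integrable_moment hc _ _, integral_moment hc _ _⟩

/-- Products of Gaussian weights are Gaussian. -/
theorem HasGaussianMoments.pi {Ω ι κ : Type*} [Fintype ι] [Fintype κ] [MeasureSpace Ω]
    [SigmaFinite (volume : Measure Ω)] {w : κ → Ω → ℂ} {h : κ → ι → Ω → ℂ} {c : κ → ι → ℂ}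
    {Z : κ → ℂ} (H : ∀ k, HasGaussianMoments volume (w k) (h k) (c k) (Z k)) :
    HasGaussianMoments volume (fun ω : κ → Ω => ∏ k, w k (ω k))
      (fun (p : κ × ι) ω => h p.1 p.2 (ω p.1)) (fun p => c p.1 p.2) (∏ k, Z k) := by
  intro m n
  have e : (fun ω : κ → Ω => (∏ p : κ × ι, (h p.1 p.2 (ω p.1) ^ m p *
      conj (h p.1 p.2 (ω p.1)) ^ n p)) * ∏ k, w k (ω k)) =
      fun ω => ∏ k, ((∏ i, (h k i (ω k) ^ m (k, i) * conj (h k i (ω k)) ^ n (k, i))) *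
        w k (ω k)) := by
    ext ω
    rw [Fintype.prod_prod_type, Finset.prod_mul_distrib]
  rw [e]
  constructor
  · exact Integrable.fintype_prod (f := fun k x => (∏ i, (h k i x ^ m (k, i) *
      conj (h k i x) ^ n (k, i))) * w k x)
      fun k => (H k (fun i => m (k, i)) (fun i => n (k, i))).1
  · rw [integral_fintype_prod_volume_eq_prod (fun k x => (∏ i, (h k i x ^ m (k, i) *
      conj (h k i x) ^ n (k, i))) * w k x), Fintype.prod_prod_type, ← Finset.prod_mul_distrib]
    exact Finset.prod_congr rfl fun k _ => (H k (fun i => m (k, i)) (fun i => n (k, i))).2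

/-! ### The Wick formula -/

section Wick

variable {Ω ι : Type*} [Fintype ι] [DecidableEq ι] [MeasurableSpace Ω] {μ : Measure Ω} {w : Ω → ℂ}
  {h : ι → Ω → ℂ} {c : ι → ℂ} {Z : ℂ}
  {R : Type*} [CommRing R] [Algebra ℚ R] [Algebra ℂ R]

theorem exp_smul_eq_sum {u : R} {k : ℕ} (hu : u ^ k = 0) (x : ℂ) :
    IsNilpotent.exp (x • u) =
      ∑ i ∈ Finset.range k, (x ^ i * (i.factorial : ℂ)⁻¹) • u ^ i := by
  rw [IsNilpotent.exp_eq_sum (k := k) (by rw [smul_pow, hu, smul_zero])]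
  refine Finset.sum_congr rfl fun i _ => ?_
  rw [smul_pow, ← Rat.cast_smul_eq_qsmul ℂ, smul_smul, mul_comm]
  simp

theorem exp_sum_smul_add_smul {u v : ι → R} {k : ℕ} (hu : ∀ i, u i ^ k = 0) (hv : ∀ i, v i ^ k = 0)
    (x y : ι → ℂ) :
    IsNilpotent.exp (∑ i, (x i • u i + y i • v i)) =
      ∑ p : ι → Fin k × Fin k, (∏ i, (x i ^ (p i).1.val * y i ^ (p i).2.val)) •
        ∏ i, (((((p i).1.val.factorial : ℂ)⁻¹ * ((p i).2.val.factorial : ℂ)⁻¹)) •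
          (u i ^ (p i).1.val * v i ^ (p i).2.val)) := by
  have h1 : ∀ i, IsNilpotent (x i • u i) := fun i => IsNilpotent.smul ⟨k, hu i⟩ _
  have h2 : ∀ i, IsNilpotent (y i • v i) := fun i => IsNilpotent.smul ⟨k, hv i⟩ _
  rw [isNilpotent_exp_sum _ _ fun i _ => (Commute.all _ _).isNilpotent_add (h1 i) (h2 i)]
  have h3 : ∀ i, IsNilpotent.exp (x i • u i + y i • v i) = ∑ q : Fin k × Fin k,
      (x i ^ q.1.val * y i ^ q.2.val) • ((((q.1.val.factorial : ℂ)⁻¹ *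
        (q.2.val.factorial : ℂ)⁻¹)) • (u i ^ q.1.val * v i ^ q.2.val)) := by
    intro i
    rw [IsNilpotent.exp_add_of_commute (Commute.all _ _) (h1 i) (h2 i), exp_smul_eq_sum (hu i),
      exp_smul_eq_sum (hv i), Fintype.sum_prod_type, Finset.sum_mul_sum, Finset.sum_range]
    refine Finset.sum_congr rfl fun a _ => ?_
    rw [Finset.sum_range]
    refine Finset.sum_congr rfl fun b _ => ?_
    rw [smul_mul_smul_comm, smul_smul]
    congr 1
    ring
  simp only [h3]
  rw [Finset.prod_univ_sum, Fintype.piFinset_univ]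
  refine Finset.sum_congr rfl fun p _ => ?_
  simp only [Algebra.smul_def, Finset.prod_mul_distrib, map_prod, map_mul]

/-- Deliberately written over the same index set and algebra elements as `exp_sum_smul_add_smul`,
with each monomial replaced by its Gaussian moment. The average can then be compared term by term.
-/
theorem exp_sum_smul_mul {u v : ι → R} {k : ℕ} (hu : ∀ i, u i ^ k = 0) (c : ι → ℂ) :
    IsNilpotent.exp (∑ i, c i • (u i * v i)) =
      ∑ p : ι → Fin k × Fin k, (∏ i, if (p i).1.val = (p i).2.val then
        ((p i).1.val.factorial * c i ^ (p i).1.val : ℂ) else 0) •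
        ∏ i, (((((p i).1.val.factorial : ℂ)⁻¹ * ((p i).2.val.factorial : ℂ)⁻¹)) •
          (u i ^ (p i).1.val * v i ^ (p i).2.val)) := by
  have huv : ∀ i, (u i * v i) ^ k = 0 := fun i => by rw [mul_pow, hu, zero_mul]
  rw [isNilpotent_exp_sum _ _ fun i _ => IsNilpotent.smul ⟨k, huv i⟩ _]
  have h3 : ∀ i, IsNilpotent.exp (c i • (u i * v i)) = ∑ q : Fin k × Fin k,
      (if q.1.val = q.2.val then (q.1.val.factorial * c i ^ q.1.val : ℂ) else 0) •
        ((((q.1.val.factorial : ℂ)⁻¹ *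
        (q.2.val.factorial : ℂ)⁻¹)) • (u i ^ q.1.val * v i ^ q.2.val)) := by
    intro i
    rw [exp_smul_eq_sum (huv i), Fintype.sum_prod_type, Finset.sum_range]
    refine Finset.sum_congr rfl fun a _ => ?_
    rw [Finset.sum_eq_single a]
    · rw [if_pos rfl, smul_smul, mul_pow]
      congr 1
      have : (a.val.factorial : ℂ) ≠ 0 := by exact_mod_cast a.val.factorial_ne_zero
      field_simp
    · intro b _ hb
      rw [if_neg fun h => hb (Fin.ext h.symm), zero_smul]
    · simp
  simp only [h3]
  rw [Finset.prod_univ_sum, Fintype.piFinset_univ]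
  refine Finset.sum_congr rfl fun p _ => ?_
  simp only [Algebra.smul_def, Finset.prod_mul_distrib, map_prod]

theorem HasGaussianMoments.integral_exp (H : HasGaussianMoments μ w h c Z) (l : R →ₗ[ℂ] ℂ)
    {u v : ι → R} (hu : ∀ i, IsNilpotent (u i)) (hv : ∀ i, IsNilpotent (v i)) (y : R) :
    Integrable (fun ω => l (y * IsNilpotent.exp
      (∑ i, (h i ω • u i + conj (h i ω) • v i))) * w ω) μ ∧
    ∫ ω, l (y * IsNilpotent.exp (∑ i, (h i ω • u i + conj (h i ω) • v i))) * w ω ∂μ =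
      Z * l (y * IsNilpotent.exp (∑ i, c i • (u i * v i))) := by
  choose a ha using hu
  choose b hb using hv
  -- One exponent that kills all `u i` and `v i` makes both expansions finite sums over the same
  -- set.
  obtain ⟨k, hk⟩ : ∃ k, ∀ i, a i ≤ k ∧ b i ≤ k :=
    ⟨∑ i, (a i + b i), fun i => by
      have := Finset.single_le_sum (f := fun i => a i + b i) (fun i _ => Nat.zero_le _)
        (Finset.mem_univ i)
      omega⟩
  have hu : ∀ i, u i ^ k = 0 := fun i => pow_eq_zero_of_le (hk i).1 (ha i)
  have hv : ∀ i, v i ^ k = 0 := fun i => pow_eq_zero_of_le (hk i).2 (hb i)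
  rw [exp_sum_smul_mul hu]
  simp only [exp_sum_smul_add_smul hu hv, Finset.mul_sum, map_sum, Finset.sum_mul, mul_smul_comm,
    map_smul, smul_eq_mul]
  have hterm : ∀ p : ι → Fin k × Fin k, ∀ r : ℂ, ∀ ω,
      (∏ i, (h i ω ^ (p i).1.val * conj (h i ω) ^ (p i).2.val)) * r * w ω =
      ((∏ i, (h i ω ^ (p i).1.val * conj (h i ω) ^ (p i).2.val)) * w ω) * r :=
    fun p r ω => by ring
  simp only [hterm]
  have hI := fun p : ι → Fin k × Fin k =>
    H (fun i => (p i).1.val) (fun i => (p i).2.val)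
  refine ⟨integrable_finsetSum _ fun p _ => (hI p).1.mul_const _, ?_⟩
  rw [integral_finsetSum _ fun p _ => (hI p).1.mul_const _]
  refine Finset.sum_congr rfl fun p _ => ?_
  rw [integral_mul_const, (hI p).2]
  ring

/-- The Gaussian average of a determinant whose entries are affine in the variables. -/
theorem HasGaussianMoments.integral_det {n : Type*} [Fintype n] [DecidableEq n]
    (H : HasGaussianMoments μ w h c Z) (M : Matrix n n ℂ) (A B : ι → Matrix n n ℂ) :
    Integrable (fun ω => (M + ∑ i, (h i ω • A i + conj (h i ω) • B i)).det * w ω) μ ∧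
    ∫ ω, (M + ∑ i, (h i ω • A i + conj (h i ω) • B i)).det * w ω ∂μ =
      Z * detEval n (IsNilpotent.exp (detVec M) *
        IsNilpotent.exp (∑ i, c i • (detVec (A i) * detVec (B i)))) := by
  have e : ∀ ω, (M + ∑ i, (h i ω • A i + conj (h i ω) • B i)).det =
      detEval n (IsNilpotent.exp (detVec M) * IsNilpotent.exp
        (∑ i, (h i ω • detVec (A i) + conj (h i ω) • detVec (B i)))) := by
    intro ω
    have e' : ∑ i, (h i ω • detVec (A i) + conj (h i ω) • detVec (B i)) =
        detVec (∑ i, (h i ω • A i + conj (h i ω) • B i)) := by simp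
    rw [e', ← IsNilpotent.exp_add_of_commute (Commute.all _ _) (isNilpotent_detVec _)
      (isNilpotent_detVec _), ← map_add, detEval_exp_detVec]
  simp only [e]
  exact H.integral_exp (detEval n) (fun i => isNilpotent_detVec (A i))
    (fun i => isNilpotent_detVec (B i)) _

end Wick

/-! ### The band profile -/

/-- The discrete gradient on `{0, …, N - 1}`. -/
def discreteGradient (N : ℕ) : Matrix (Fin (N - 1)) (Fin N) ℝ := Matrix.of fun i j =>
  (if (j : ℕ) = i then 1 else 0) - (if (j : ℕ) = i + 1 then 1 else 0)

theorem sum_fin_indicator_mul (m a b s t : ℕ) :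
    ∑ i : Fin m, (if a = i + s then (1 : ℝ) else 0) * (if b = i + t then 1 else 0) =
      if s ≤ a ∧ b + s = a + t ∧ a < m + s then 1 else 0 := by
  split_ifs with h
  · rw [Finset.sum_eq_single ⟨a - s, by omega⟩]
    · rw [if_pos (by simp; omega), if_pos (by simp; omega), one_mul]
    · intro i _ hi
      rw [if_neg fun h' => hi (Fin.ext (by simp; omega)), zero_mul]
    · simp
  · refine Finset.sum_eq_zero fun i _ => ?_
    have := i.isLt
    by_cases h1 : a = i + s
    · rw [if_neg (by omega : ¬ b = i + t), mul_zero]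
    · rw [if_neg h1, zero_mul]

theorem negLaplacian_eq (N : ℕ) :
    negLaplacian N = (discreteGradient N)ᵀ * discreteGradient N := by
  ext j k
  have hj := j.isLt
  have hk := k.isLt
  have h00 := sum_fin_indicator_mul (N - 1) j k 0 0
  have h01 := sum_fin_indicator_mul (N - 1) j k 0 1
  have h10 := sum_fin_indicator_mul (N - 1) j k 1 0
  have h11 := sum_fin_indicator_mul (N - 1) j k 1 1
  simp only [add_zero] at h00 h01 h10 h11
  rw [Matrix.mul_apply]
  simp only [Matrix.transpose_apply, discreteGradient, Matrix.of_apply, sub_mul, mul_sub,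
    Finset.sum_sub_distrib, h00, h01, h10, h11, negLaplacian, Fin.ext_iff]
  rcases lt_trichotomy (j : ℕ) k with h | h | h
  · split_ifs <;> first | (exfalso; omega) | norm_num
  · rw [if_pos h, if_neg (by omega : ¬ ((j : ℕ) + 1 = k ∨ (k : ℕ) + 1 = j)),
      if_neg (by omega : ¬ (0 ≤ (j : ℕ) ∧ (k : ℕ) = j + 1 ∧ (j : ℕ) < N - 1)),
      if_neg (by omega : ¬ (1 ≤ (j : ℕ) ∧ (k : ℕ) + 1 = j ∧ (j : ℕ) < N - 1 + 1))]
    by_cases h1 : 0 < (j : ℕ)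
    · by_cases h2 : (j : ℕ) + 1 < N
      · rw [if_pos h1, if_pos h2, if_pos (by omega), if_pos (by omega)]; norm_num
      · rw [if_pos h1, if_neg h2, if_neg (by omega), if_pos (by omega)]; norm_num
    · by_cases h2 : (j : ℕ) + 1 < N
      · rw [if_neg h1, if_pos h2, if_pos (by omega), if_neg (by omega)]; norm_num
      · rw [if_neg h1, if_neg h2, if_neg (by omega), if_neg (by omega)]; norm_num
  · split_ifs <;> first | (exfalso; omega) | norm_num

/-- The inverse covariance `-W²Δ + 1`. -/
def precision (N : ℕ) (W : ℝ) : Matrix (Fin N) (Fin N) ℝ := W ^ 2 • negLaplacian N + 1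

theorem precision_posDef (N : ℕ) (W : ℝ) : (precision N W).PosDef := by
  refine Matrix.PosDef.posSemidef_add ?_ Matrix.PosDef.one
  rw [negLaplacian_eq]
  have := Matrix.posSemidef_conjTranspose_mul_self (discreteGradient N)
  rw [Matrix.conjTranspose_eq_transpose_of_trivial] at this
  exact this.smul (sq_nonneg W)

theorem profile_eq (N : ℕ) (W : ℝ) : profile N W = (precision N W)⁻¹ := rfl

-- Any square root serves: with `C = B⁻¹` one gets `J = C * Cᵀ`, the covariance factorization needed
-- for the dual field.
open scoped MatrixOrder Matrix.Norms.L2Operator in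
theorem exists_precision_eq (N : ℕ) (W : ℝ) :
    ∃ B : Matrix (Fin N) (Fin N) ℝ, precision N W = Bᵀ * B ∧ B.det ≠ 0 := by
  obtain ⟨B, hB⟩ := CStarAlgebra.nonneg_iff_eq_star_mul_self.mp
    (precision_posDef N W).posSemidef.nonneg
  rw [Matrix.star_eq_conjTranspose, Matrix.conjTranspose_eq_transpose_of_trivial] at hB
  refine ⟨B, hB, fun h => ?_⟩
  have := (precision_posDef N W).det_pos
  rw [hB, Matrix.det_mul, h, mul_zero] at this
  exact lt_irrefl _ this

theorem precision_mulVec_apply {N : ℕ} (W : ℝ) (x : Fin N → ℝ) (i : Fin N) :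
    (precision N W *ᵥ x) i =
      x i + W ^ 2 * ∑ k : Fin N, if (i : ℕ) + 1 = k ∨ (k : ℕ) + 1 = i then x i - x k else 0 := by
  -- Constants are annihilated, so subtracting `x i` times this row sum turns the diagonal term into
  -- differences `x i - x k`.
  have h1 : (negLaplacian N *ᵥ fun _ => (1 : ℝ)) = 0 := by
    rw [negLaplacian_eq, ← Matrix.mulVec_mulVec]
    have : (discreteGradient N *ᵥ fun _ => (1 : ℝ)) = 0 := by
      ext m
      simp only [Matrix.mulVec, dotProduct, discreteGradient, Matrix.of_apply, mul_one,
        Finset.sum_sub_distrib, Pi.zero_apply]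
      have hm := m.isLt
      rw [Finset.sum_eq_single ⟨m, by omega⟩, Finset.sum_eq_single ⟨m + 1, by omega⟩]
      · simp
      · intro b _ hb
        rw [if_neg fun h => hb (Fin.ext h)]
      · simp
      · intro b _ hb
        rw [if_neg fun h => hb (Fin.ext h)]
      · simp
    rw [this, Matrix.mulVec_zero]
  have h2 : (negLaplacian N *ᵥ x) i =
      ∑ k : Fin N, if (i : ℕ) + 1 = k ∨ (k : ℕ) + 1 = i then x i - x k else 0 := by
    have h3 : (negLaplacian N *ᵥ x) i =
        (negLaplacian N *ᵥ x) i - x i * (negLaplacian N *ᵥ fun _ => (1 : ℝ)) i := by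
      rw [h1]; simp
    rw [h3]
    simp only [Matrix.mulVec, dotProduct, Finset.mul_sum]
    rw [← Finset.sum_sub_distrib]
    refine Finset.sum_congr rfl fun k _ => ?_
    by_cases hik : i = k
    · subst hik
      simp
      ring
    · simp only [negLaplacian, Matrix.of_apply, if_neg hik]
      split_ifs <;> ring
  rw [precision, Matrix.add_mulVec, Matrix.smul_mulVec, Matrix.one_mulVec, Pi.add_apply,
    Pi.smul_apply, h2, smul_eq_mul, add_comm]

/-- Strong maximum principle. A negative minimum contradicts the inequality at that site; a zero
forces its neighbours to be zero, hence the whole chain by connectedness. Applied to the columns of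
`J`, it gives strictly positive variances. -/
theorem pos_of_precision_mulVec {N : ℕ} {W : ℝ} (hW : 0 < W) {x : Fin N → ℝ}
    (hx : 0 ≤ precision N W *ᵥ x) (hx0 : x ≠ 0) (j : Fin N) : 0 < x j := by
  have hW2 : 0 < W ^ 2 := by positivity
  have : Nonempty (Fin N) := ⟨j⟩
  obtain ⟨i, hi⟩ := Finite.exists_min x
  have hnn : 0 ≤ x i := by
    by_contra! hneg
    have h := hx i
    rw [Pi.zero_apply, precision_mulVec_apply] at h
    have : ∑ k : Fin N, (if (i : ℕ) + 1 = k ∨ (k : ℕ) + 1 = i then x i - x k else 0) ≤ 0 := by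
      refine Finset.sum_nonpos fun k _ => ?_
      split_ifs
      · linarith [hi k]
      · exact le_rfl
    nlinarith
  have hnonneg : ∀ k, 0 ≤ x k := fun k => hnn.trans (hi k)
  have step : ∀ i k : Fin N, x i = 0 → ((i : ℕ) + 1 = k ∨ (k : ℕ) + 1 = i) → x k = 0 := by
    intro i k h0 hik
    have h := hx i
    rw [Pi.zero_apply, precision_mulVec_apply, h0, zero_add] at h
    have hterm : ∀ l ∈ (Finset.univ : Finset (Fin N)),
        (if (i : ℕ) + 1 = l ∨ (l : ℕ) + 1 = i then 0 - x l else 0) ≤ 0 := by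
      intro l _
      split_ifs
      · linarith [hnonneg l]
      · exact le_rfl
    have hs := Finset.sum_nonpos hterm
    have hs0 : ∑ l : Fin N, (if (i : ℕ) + 1 = l ∨ (l : ℕ) + 1 = i then 0 - x l else 0) = 0 :=
      le_antisymm hs (nonneg_of_mul_nonneg_right h hW2)
    have := (Finset.sum_eq_zero_iff_of_nonpos hterm).1 hs0 k (Finset.mem_univ _)
    rw [if_pos hik] at this
    linarith
  by_contra! hj
  have hj0 : x j = 0 := le_antisymm hj (hnonneg j)
  apply hx0
  have up : ∀ m : ℕ, ∀ h : j + m < N, x ⟨j + m, h⟩ = 0 := by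
    intro m
    induction m with
    | zero => intro h; exact hj0
    | succ m ih => intro h; exact step ⟨j + m, by omega⟩ _ (ih _) (Or.inl (by simp; omega))
  have down : ∀ m : ℕ, m ≤ j → ∀ h : j - m < N, x ⟨j - m, h⟩ = 0 := by
    intro m
    induction m with
    | zero => intro _ h; exact hj0
    | succ m ih =>
      intro hm h
      exact step ⟨j - m, by omega⟩ _ (ih (by omega) _) (Or.inr (by simp; omega))
  ext k
  rcases le_total (j : ℕ) k with h | h
  · have := up (k - j) (by have := k.isLt; omega)
    have e : (⟨j + (k - j), by have := k.isLt; omega⟩ : Fin N) = k := Fin.ext (by simp; omega)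
    rwa [e] at this
  · have := down (j - k) (by omega) (by have := k.isLt; omega)
    have e : (⟨j - (j - k), by have := k.isLt; omega⟩ : Fin N) = k := Fin.ext (by simp; omega)
    rwa [e] at this

theorem profile_pos {N : ℕ} {W : ℝ} (hW : 0 < W) (j k : Fin N) : 0 < profile N W j k := by
  have hu : IsUnit (precision N W).det :=
    (Matrix.isUnit_iff_isUnit_det _).1 (precision_posDef N W).isUnit
  have h : precision N W *ᵥ (profile N W *ᵥ Pi.single k 1) = Pi.single k 1 := by
    rw [profile_eq, Matrix.mulVec_mulVec, Matrix.mul_nonsing_inv _ hu, Matrix.one_mulVec]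
  have := pos_of_precision_mulVec hW (x := profile N W *ᵥ Pi.single k 1)
    (by rw [h]; exact Pi.single_nonneg.2 zero_le_one) (by
      intro h0
      rw [h0, Matrix.mulVec_zero] at h
      have := congrFun h k
      simp at this) j
  simpa using this

theorem discreteGradient_mulVec {N : ℕ} (q : Fin N → ℂ) (i : Fin (N - 1)) :
    ∑ j, (discreteGradient N i j : ℂ) * q j = q ⟨i, by have := i.isLt; omega⟩ -
      q ⟨i + 1, by have := i.isLt; omega⟩ := by
  have hi := i.isLt
  have h : ∀ j : Fin N, (discreteGradient N i j : ℂ) * q j =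
      (if j = ⟨i, by omega⟩ then q j else 0) - (if j = ⟨i + 1, by omega⟩ then q j else 0) := by
    intro j
    simp only [discreteGradient, Matrix.of_apply, Fin.ext_iff]
    split_ifs <;> simp
  simp only [h, Finset.sum_sub_distrib, Finset.sum_ite_eq', Finset.mem_univ, if_true]

theorem quadForm_conjTranspose_mul {m n : Type*} [Fintype m] [Fintype n] (D : Matrix m n ℝ)
    (q : n → ℂ) :
    ∑ j, ∑ k, ((Dᵀ * D) j k : ℂ) * (q j * conj (q k)) =
      ((∑ i, ‖∑ j, (D i j : ℂ) * q j‖ ^ 2 : ℝ) : ℂ) := by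
  have h : ∀ i, ((‖∑ j, (D i j : ℂ) * q j‖ ^ 2 : ℝ) : ℂ) =
      ∑ j, ∑ k, ((D i j * D i k : ℝ) : ℂ) * (q j * conj (q k)) := by
    intro i
    rw [← Complex.normSq_eq_norm_sq, ← Complex.mul_conj, map_sum, Finset.sum_mul_sum]
    refine Finset.sum_congr rfl fun j _ => Finset.sum_congr rfl fun k _ => ?_
    rw [map_mul, Complex.conj_ofReal]
    push_cast
    ring
  symm
  rw [Complex.ofReal_sum, Finset.sum_congr rfl fun i _ => h i, Finset.sum_comm]
  refine Finset.sum_congr rfl fun j _ => ?_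
  rw [Finset.sum_comm]
  refine Finset.sum_congr rfl fun k _ => ?_
  rw [← Finset.sum_mul, Matrix.mul_apply]
  simp

/-- The Dirichlet form of the chain. -/
theorem quadForm_precision {N : ℕ} (W : ℝ) (q : Fin N → ℂ) :
    ∑ j, ∑ k, (precision N W j k : ℂ) * (q j * conj (q k)) =
    (((∑ j, ‖q j‖ ^ 2) + W ^ 2 * ∑ i : Fin (N - 1), ‖q ⟨i, by have := i.isLt; omega⟩ -
      q ⟨i + 1, by have := i.isLt; omega⟩‖ ^ 2 : ℝ) : ℂ) := by
  have h := quadForm_conjTranspose_mul (discreteGradient N) q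
  simp only [discreteGradient_mulVec] at h
  rw [← negLaplacian_eq] at h
  have h1 := quadForm_conjTranspose_mul (1 : Matrix (Fin N) (Fin N) ℝ) q
  have h2 : ∀ i : Fin N, ∑ j : Fin N, ((1 : Matrix (Fin N) (Fin N) ℝ) i j : ℂ) * q j = q i := by
    intro i
    rw [Finset.sum_eq_single i]
    · simp
    · intro j _ hj; simp [Matrix.one_apply_ne hj.symm]
    · simp
  simp only [h2, Matrix.transpose_one, one_mul] at h1
  rw [Complex.ofReal_add, Complex.ofReal_mul, ← h, ← h1, Finset.mul_sum, ← Finset.sum_add_distrib]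
  refine Finset.sum_congr rfl fun j _ => ?_
  rw [Finset.mul_sum, ← Finset.sum_add_distrib]
  refine Finset.sum_congr rfl fun k _ => ?_
  rw [precision, Matrix.add_apply, Matrix.smul_apply, smul_eq_mul]
  push_cast
  ring

/-! ### Duality between the two Gaussian averages -/

/-- The index set of the block matrices: a block index and a site. -/
abbrev BlockIndex (N : ℕ) : Type := (Fin 2 ⊕ Fin 2) × Fin N

/-- The diagonal part `diag(ẑ, ẑ^*)` at every site. -/
def blockShift (N : ℕ) (z₁ z₂ : ℂ) : Matrix (BlockIndex N) (BlockIndex N) ℂ :=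
  Matrix.blockDiagonal fun _ => calQ z₁ z₂ 0

/-- The coefficient of `H_{jk}` in the block matrix of `ẑ - H`, `(ẑ - H)^*`. -/
def bandCoeff {N : ℕ} (p : Fin N × (Fin N × Unit)) : Matrix (BlockIndex N) (BlockIndex N) ℂ :=
  ∑ s : Fin 2, Matrix.single (Sum.inl s, p.1) (Sum.inl s, p.2.1) (-1)

/-- The coefficient of `conj H_{jk}` in the block matrix of `ẑ - H`, `(ẑ - H)^*`. -/
def bandCoeffConj {N : ℕ} (p : Fin N × (Fin N × Unit)) : Matrix (BlockIndex N) (BlockIndex N) ℂ :=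
  ∑ s : Fin 2, Matrix.single (Sum.inr s, p.2.1) (Sum.inr s, p.1) (-1)

/-- The coefficient of `G_{l,s,t}` in `⨁_j 𝒬((C G)_j)`. -/
def dualCoeff {N : ℕ} (C : Matrix (Fin N) (Fin N) ℝ) (p : Fin N × (Fin 2 × (Fin 2 × Unit))) :
    Matrix (BlockIndex N) (BlockIndex N) ℂ :=
  ∑ j, (C j p.1 : ℂ) • Matrix.single (Sum.inl p.2.1, j) (Sum.inr p.2.2.1, j) Complex.I

/-- The coefficient of `conj G_{l,s,t}` in `⨁_j 𝒬((C G)_j)`. -/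
def dualCoeffConj {N : ℕ} (C : Matrix (Fin N) (Fin N) ℝ) (p : Fin N × (Fin 2 × (Fin 2 × Unit))) :
    Matrix (BlockIndex N) (BlockIndex N) ℂ :=
  ∑ j, (C j p.1 : ℂ) • Matrix.single (Sum.inr p.2.2.1, j) (Sum.inl p.2.1, j) Complex.I

/-- The action of a matrix on the sites. -/
def siteMap {N : ℕ} (C : Matrix (Fin N) (Fin N) ℝ) : (Fin N → Mat2) →ₗ[ℂ] (Fin N → Mat2) where
  toFun G := fun j => ∑ l, (C j l : ℂ) • G l
  map_add' G G' := by ext; simp [Finset.sum_add_distrib]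
  map_smul' c G := by ext; simp [Finset.mul_sum, mul_left_comm]

theorem siteMap_apply {N : ℕ} (C : Matrix (Fin N) (Fin N) ℝ) (G : Fin N → Mat2) (j : Fin N)
    (s t : Fin 2) : siteMap C G j s t = ∑ l, (C j l : ℂ) * G l s t := by
  simp [siteMap]

/-- The core of the duality. On the band side the units pair sites `(j, k)` and `(k, j)` within a
replica; `detUnit_mul_swap` regroups them into two units, each at a single site, at the cost of a
sign. The dual side produces the same sign from `I * I` and the same weight from `C * Cᵀ`. -/
theorem wick_exponent_eq {N : ℕ} {J C : Matrix (Fin N) (Fin N) ℝ} (hJ : J = C * Cᵀ) :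
    ∑ p : Fin N × (Fin N × Unit), (J p.1 p.2.1 : ℂ) •
      (detVec (bandCoeff p) * detVec (bandCoeffConj p)) =
    ∑ p : Fin N × (Fin 2 × (Fin 2 × Unit)), (1 : ℂ) •
      (detVec (dualCoeff C p) * detVec (dualCoeffConj C p)) := by
  have hl : ∑ p : Fin N × (Fin N × Unit), (J p.1 p.2.1 : ℂ) •
      (detVec (bandCoeff p) * detVec (bandCoeffConj p)) =
      ∑ j, ∑ k, ∑ s : Fin 2, ∑ t : Fin 2, (-J j k : ℂ) •
        (detUnit ((Sum.inl s, j) : BlockIndex N) (Sum.inr t, j) *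
          detUnit ((Sum.inr t, k) : BlockIndex N) (Sum.inl s, k)) := by
    simp only [Fintype.sum_prod_type, Finset.univ_unique, Finset.sum_singleton]
    refine Finset.sum_congr rfl fun j _ => Finset.sum_congr rfl fun k _ => ?_
    simp only [bandCoeff, bandCoeffConj, map_sum, detVec_single, Finset.sum_mul_sum,
      Finset.smul_sum]
    refine Finset.sum_congr rfl fun s _ => Finset.sum_congr rfl fun t _ => ?_
    rw [smul_mul_smul_comm, detUnit_mul_swap]
    simp
  have hr : ∀ s t : Fin 2, ∑ l, (1 : ℂ) •
      (detVec (dualCoeff C (l, s, t, ())) * detVec (dualCoeffConj C (l, s, t, ()))) =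
      ∑ j, ∑ k, (-J j k : ℂ) •
        (detUnit ((Sum.inl s, j) : BlockIndex N) (Sum.inr t, j) *
          detUnit ((Sum.inr t, k) : BlockIndex N) (Sum.inl s, k)) := by
    intro s t
    simp only [dualCoeff, dualCoeffConj, map_sum, map_smul, detVec_single, Finset.sum_mul_sum,
      one_smul]
    rw [Finset.sum_comm]
    refine Finset.sum_congr rfl fun j _ => ?_
    rw [Finset.sum_comm]
    refine Finset.sum_congr rfl fun k _ => ?_
    rw [hJ, Matrix.mul_apply]
    simp only [smul_smul, smul_mul_smul_comm]
    rw [← Finset.sum_smul]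
    congr 1
    rw [Complex.ofReal_sum, ← Finset.sum_neg_distrib]
    refine Finset.sum_congr rfl fun l _ => ?_
    rw [Matrix.transpose_apply]
    push_cast
    linear_combination (C j l * C k l : ℂ) * Complex.I_mul_I
  rw [hl]
  simp only [Fintype.sum_prod_type, Finset.univ_unique, Finset.sum_singleton]
  have hc : ∀ F : Fin N → Fin 2 → Fin 2 → DetAlgebra (BlockIndex N),
      ∑ l, ∑ s, ∑ t, F l s t = ∑ s, ∑ t, ∑ l, F l s t := by
    intro F
    rw [Finset.sum_comm]
    exact Finset.sum_congr rfl fun s _ => Finset.sum_comm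
  rw [hc]
  simp only [PUnit.default_eq_unit, hr]
  have hc2 : ∀ F : Fin N → Fin N → Fin 2 → Fin 2 → DetAlgebra (BlockIndex N),
      ∑ j, ∑ k, ∑ s, ∑ t, F j k s t = ∑ s, ∑ t, ∑ j, ∑ k, F j k s t := by
    intro F
    rw [← hc]
    refine Finset.sum_congr rfl fun j _ => ?_
    rw [hc]
  exact hc2 _

theorem det_dual {N : ℕ} (C : Matrix (Fin N) (Fin N) ℝ) (z₁ z₂ : ℂ) (G : Fin N → Mat2) :
    (blockShift N z₁ z₂ + ∑ p : Fin N × (Fin 2 × (Fin 2 × Unit)),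
      (G p.1 p.2.1 p.2.2.1 • dualCoeff C p + conj (G p.1 p.2.1 p.2.2.1) • dualCoeffConj C p)).det =
    ∏ j, (calQ z₁ z₂ (siteMap C G j)).det := by
  rw [← Matrix.det_blockDiagonal]
  congr 1
  have h1 : ∑ p : Fin N × (Fin 2 × (Fin 2 × Unit)),
      (G p.1 p.2.1 p.2.2.1 • dualCoeff C p + conj (G p.1 p.2.1 p.2.2.1) • dualCoeffConj C p) =
      ∑ j, ∑ s, ∑ t, (siteMap C G j s t •
          Matrix.single ((Sum.inl s, j) : BlockIndex N) (Sum.inr t, j) Complex.I +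
        conj (siteMap C G j s t) •
          Matrix.single ((Sum.inr t, j) : BlockIndex N) (Sum.inl s, j) Complex.I) := by
    simp only [Fintype.sum_prod_type, Finset.univ_unique, Finset.sum_singleton, dualCoeff,
      dualCoeffConj, siteMap_apply, map_sum, map_mul, Complex.conj_ofReal, Finset.sum_smul,
      Finset.smul_sum, ← Finset.sum_add_distrib, smul_smul, mul_comm]
    have hc : ∀ F : Fin N → Fin N → Fin 2 → Fin 2 → Matrix (BlockIndex N) (BlockIndex N) ℂ,
        ∑ l, ∑ s, ∑ t, ∑ j, F l j s t = ∑ j, ∑ s, ∑ t, ∑ l, F l j s t := by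
      intro F
      have hd : ∀ F : Fin N → Fin 2 → Fin 2 → Matrix (BlockIndex N) (BlockIndex N) ℂ,
          ∑ s, ∑ t, ∑ l, F l s t = ∑ l, ∑ s, ∑ t, F l s t := by
        intro F
        symm
        rw [Finset.sum_comm]
        exact Finset.sum_congr rfl fun s _ => Finset.sum_comm
      simp only [hd]
      exact Finset.sum_comm
    exact hc _
  rw [h1]
  ext ⟨a, j⟩ ⟨b, k⟩
  simp only [Matrix.add_apply, blockShift, Matrix.sum_apply, Matrix.smul_apply, smul_eq_mul,
    Matrix.blockDiagonal_apply]
  by_cases hjk : j = k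
  · subst hjk
    rcases a with a | a <;> rcases b with b | b <;>
    simp [Matrix.single_apply, calQ, ite_and, mul_comm]
  · have hjk' : ∀ x, ¬ (x = j ∧ x = k) := fun x h => hjk (h.1.symm.trans h.2)
    rw [if_neg hjk, if_neg hjk, zero_add]
    refine Finset.sum_eq_zero fun x _ => Finset.sum_eq_zero fun s _ => Finset.sum_eq_zero
      fun t _ => ?_
    have := hjk' x
    simp only [Matrix.single_apply, Prod.mk.injEq]
    rw [if_neg (by tauto), if_neg (by tauto)]
    simp

theorem det_band {N : ℕ} (z₁ z₂ : ℂ) (H : Fin N → Fin N → ℂ) :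
    (blockShift N z₁ z₂ + ∑ p : Fin N × (Fin N × Unit),
      (H p.1 p.2.1 • bandCoeff p + conj (H p.1 p.2.1) • bandCoeffConj p)).det =
    charProd z₁ H * charProd z₂ H := by
  let D : Fin 2 ⊕ Fin 2 → Matrix (Fin N) (Fin N) ℂ :=
    Sum.elim (fun s => (![z₁, z₂] s) • 1 - Matrix.of H) fun s => ((![z₁, z₂] s) • 1 - Matrix.of H)ᴴ
  have h1 : blockShift N z₁ z₂ + ∑ p : Fin N × (Fin N × Unit),
      (H p.1 p.2.1 • bandCoeff p + conj (H p.1 p.2.1) • bandCoeffConj p) =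
      (Matrix.blockDiagonal D).submatrix Prod.swap Prod.swap := by
    ext ⟨a, j⟩ ⟨b, k⟩
    simp only [Fintype.sum_prod_type, Finset.univ_unique, Finset.sum_singleton, bandCoeff,
      bandCoeffConj, Finset.sum_add_distrib, Matrix.add_apply, Matrix.sum_apply, Matrix.smul_apply,
      smul_eq_mul, blockShift, Matrix.blockDiagonal_apply, Matrix.submatrix_apply,
      Prod.swap_prod_mk]
    rcases eq_or_ne j k with hjk | hjk <;>
    rcases a with a | a <;> rcases b with b | b <;>
    rcases eq_or_ne a b with hab | hab <;>
    simp [Matrix.single_apply, calQ, ite_and, D, hjk, hab, sub_eq_add_neg]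
  have h2 : ∀ s, (D (Sum.inl s)).det * (D (Sum.inr s)).det = charProd (![z₁, z₂] s) H := by
    intro s
    have : ![z₁, z₂] s • (1 : Matrix (Fin N) (Fin N) ℂ) - Matrix.of H =
        -(Matrix.of H - ![z₁, z₂] s • (1 : Matrix (Fin N) (Fin N) ℂ)) := by abel
    simp only [D, Sum.elim_inl, Sum.elim_inr, charProd, this, Matrix.conjTranspose_neg,
      Matrix.det_neg, Fintype.card_fin]
    -- The blocks are `z - H` rather than `H - z`; the signs cancel between each block and its
    -- adjoint.
    have h3 : ((-1 : ℂ) ^ N) * (-1) ^ N = 1 := by rw [← mul_pow]; simp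
    linear_combination ((Matrix.of H - ![z₁, z₂] s • (1 : Matrix (Fin N) (Fin N) ℂ)).det *
      (Matrix.of H - ![z₁, z₂] s • (1 : Matrix (Fin N) (Fin N) ℂ))ᴴ.det) * h3
  have h4 := Matrix.det_submatrix_equiv_self (Equiv.prodComm (Fin 2 ⊕ Fin 2) (Fin N))
    (Matrix.blockDiagonal D)
  rw [h1]
  refine h4.trans ?_
  rw [Matrix.det_blockDiagonal, Fintype.prod_sum_type, ← Finset.prod_mul_distrib]
  simp only [h2, Fin.prod_univ_two]
  simp

/-! ### The average over the band matrix -/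

theorem hasGaussianMoments_band (N : ℕ) {W : ℝ} (hW : 0 < W) :
    HasGaussianMoments volume
      (fun H : Fin N → Fin N → ℂ => ∏ j, ∏ k, (Real.exp (-‖H j k‖ ^ 2 / profile N W j k) : ℂ))
      (fun (p : Fin N × (Fin N × Unit)) H => H p.1 p.2.1) (fun p => (profile N W p.1 p.2.1 : ℂ))
      (∏ j, ∏ k, (Real.pi * profile N W j k : ℂ)) :=
  HasGaussianMoments.pi
    (w := fun j (x : Fin N → ℂ) => ∏ k, (Real.exp (-‖x k‖ ^ 2 / profile N W j k) : ℂ))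
    (h := fun _ (p : Fin N × Unit) x => x p.1) (c := fun j p => (profile N W j p.1 : ℂ))
    (Z := fun j => ∏ k, (Real.pi * profile N W j k : ℂ))
    fun j => HasGaussianMoments.pi
      (w := fun k (x : ℂ) => (Real.exp (-‖x‖ ^ 2 / profile N W j k) : ℂ))
      (h := fun _ (_ : Unit) x => x) (c := fun k _ => (profile N W j k : ℂ))
      (Z := fun k => (Real.pi * profile N W j k : ℂ))
      fun k => hasGaussianMoments_complex (profile_pos hW j k)

theorem hasGaussianMoments_mat2 :
    HasGaussianMoments volume
      (fun Q : Mat2 => ∏ s, ∏ t, (Real.exp (-‖Q s t‖ ^ 2 / 1) : ℂ))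
      (fun (p : Fin 2 × (Fin 2 × Unit)) Q => Q p.1 p.2.1) (fun _ => ((1 : ℝ) : ℂ))
      (∏ _s : Fin 2, ∏ _t : Fin 2, (Real.pi * (1 : ℝ) : ℂ)) :=
  HasGaussianMoments.pi
    (w := fun _ (x : Fin 2 → ℂ) => ∏ t, (Real.exp (-‖x t‖ ^ 2 / 1) : ℂ))
    (h := fun _ (p : Fin 2 × Unit) x => x p.1) (c := fun _ _ => ((1 : ℝ) : ℂ))
    (Z := fun _ => ∏ _t : Fin 2, (Real.pi * (1 : ℝ) : ℂ))
    fun _ => HasGaussianMoments.pi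
      (w := fun _ (x : ℂ) => (Real.exp (-‖x‖ ^ 2 / 1) : ℂ))
      (h := fun _ (_ : Unit) x => x) (c := fun _ _ => ((1 : ℝ) : ℂ))
      (Z := fun _ => (Real.pi * (1 : ℝ) : ℂ))
      fun _ => hasGaussianMoments_complex one_pos

theorem hasGaussianMoments_standard (N : ℕ) :
    HasGaussianMoments volume
      (fun G : Fin N → Mat2 => ∏ l, ∏ s, ∏ t, (Real.exp (-‖G l s t‖ ^ 2 / 1) : ℂ))
      (fun (p : Fin N × (Fin 2 × (Fin 2 × Unit))) G => G p.1 p.2.1 p.2.2.1)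
      (fun _ => ((1 : ℝ) : ℂ)) (∏ _l : Fin N, ∏ _s : Fin 2, ∏ _t : Fin 2,
        (Real.pi * (1 : ℝ) : ℂ)) :=
  HasGaussianMoments.pi
    (w := fun _ (x : Mat2) => ∏ s, ∏ t, (Real.exp (-‖x s t‖ ^ 2 / 1) : ℂ))
    (h := fun _ (p : Fin 2 × (Fin 2 × Unit)) x => x p.1 p.2.1) (c := fun _ _ => ((1 : ℝ) : ℂ))
    (Z := fun _ => ∏ _s : Fin 2, ∏ _t : Fin 2, (Real.pi * (1 : ℝ) : ℂ))
    fun _ => hasGaussianMoments_mat2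

/-- The density of `law N W`. -/
def lawDensity (N : ℕ) (W : ℝ) (H : Fin N → Fin N → ℂ) : ℝ :=
  ∏ j, ∏ k, (Real.pi * profile N W j k)⁻¹ * Real.exp (-‖H j k‖ ^ 2 / profile N W j k)

theorem lawDensity_nonneg {N : ℕ} {W : ℝ} (hW : 0 < W) (H : Fin N → Fin N → ℂ) :
    0 ≤ lawDensity N W H :=
  Finset.prod_nonneg fun j _ => Finset.prod_nonneg fun k _ => by
    have := profile_pos hW j k
    positivity

theorem measurable_lawDensity (N : ℕ) (W : ℝ) : Measurable (lawDensity N W) := by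
  unfold lawDensity
  fun_prop

theorem lawDensity_eq (N : ℕ) (W : ℝ) (H : Fin N → Fin N → ℂ) :
    (lawDensity N W H : ℂ) = (∏ j, ∏ k, (Real.exp (-‖H j k‖ ^ 2 / profile N W j k) : ℂ)) *
      (∏ j, ∏ k, (Real.pi * profile N W j k : ℂ))⁻¹ := by
  simp only [lawDensity, Finset.prod_mul_distrib, Finset.prod_inv_distrib]
  push_cast
  ring

theorem normalization_ne_zero {N : ℕ} {W : ℝ} (hW : 0 < W) :
    (∏ j : Fin N, ∏ k : Fin N, (Real.pi * profile N W j k : ℂ)) ≠ 0 := by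
  refine Finset.prod_ne_zero_iff.2 fun j _ => Finset.prod_ne_zero_iff.2 fun k _ => ?_
  have h1 := (profile_pos hW j k).ne'
  have h2 := Real.pi_ne_zero
  exact mul_ne_zero (by exact_mod_cast h2) (by exact_mod_cast h1)

theorem integral_lawDensity {N : ℕ} {W : ℝ} (hW : 0 < W) :
    Integrable (lawDensity N W) ∧ ∫ H, lawDensity N W H = 1 := by
  -- The moment of order zero is the total mass.
  have h := hasGaussianMoments_band N hW 0 0
  simp only [Pi.zero_apply, pow_zero, mul_one, Finset.prod_const_one, one_mul, if_true,
    Nat.factorial_zero, Nat.cast_one] at h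
  have h1 : Integrable (fun H => (lawDensity N W H : ℂ)) := by
    simp only [lawDensity_eq]
    exact h.1.mul_const _
  have h2 : ∫ H, (lawDensity N W H : ℂ) = 1 := by
    simp only [lawDensity_eq]
    rw [integral_mul_const, h.2, mul_inv_cancel₀ (normalization_ne_zero hW)]
  refine ⟨?_, ?_⟩
  · simpa using h1.re
  · rw [integral_complex_ofReal] at h2
    exact_mod_cast h2

theorem isProbabilityMeasure_law (N : ℕ) {W : ℝ} (hW : 0 < W) :
    IsProbabilityMeasure (law N W) := by
  constructor
  rw [law, withDensity_apply _ MeasurableSet.univ, Measure.restrict_univ]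
  change ∫⁻ H, ENNReal.ofReal (lawDensity N W H) = 1
  rw [← ofReal_integral_eq_lintegral_ofReal (integral_lawDensity hW).1
    (Filter.Eventually.of_forall (lawDensity_nonneg hW)), (integral_lawDensity hW).2,
    ENNReal.ofReal_one]

theorem integrable_law_iff {N : ℕ} {W : ℝ} (hW : 0 < W) (F : (Fin N → Fin N → ℂ) → ℂ) :
    Integrable F (law N W) ↔ Integrable fun H => F H * (lawDensity N W H : ℂ) := by
  have hm : Measurable fun H => ENNReal.ofReal (lawDensity N W H) :=
    (measurable_lawDensity N W).ennreal_ofReal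
  change Integrable F (volume.withDensity fun H => ENNReal.ofReal (lawDensity N W H)) ↔ _
  rw [integrable_withDensity_iff_integrable_smul' hm
    (Filter.Eventually.of_forall fun _ => ENNReal.ofReal_lt_top)]
  refine integrable_congr (Filter.Eventually.of_forall fun H => ?_)
  simp only [ENNReal.toReal_ofReal (lawDensity_nonneg hW H), Complex.real_smul]
  ring

theorem integral_law {N : ℕ} {W : ℝ} (hW : 0 < W) (F : (Fin N → Fin N → ℂ) → ℂ) :
    ∫ H, F H ∂(law N W) = ∫ H, F H * (lawDensity N W H : ℂ) := by
  have hm : Measurable fun H => ENNReal.ofReal (lawDensity N W H) :=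
    (measurable_lawDensity N W).ennreal_ofReal
  change ∫ H, F H ∂(volume.withDensity fun H => ENNReal.ofReal (lawDensity N W H)) = _
  rw [integral_withDensity_eq_integral_toReal_smul hm
    (Filter.Eventually.of_forall fun _ => ENNReal.ofReal_lt_top)]
  refine integral_congr_ae (Filter.Eventually.of_forall fun H => ?_)
  simp only [ENNReal.toReal_ofReal (lawDensity_nonneg hW H), Complex.real_smul]
  ring

/-- The common value of the two Gaussian averages. -/
def dualValue {N : ℕ} (C : Matrix (Fin N) (Fin N) ℝ) (z₁ z₂ : ℂ) : ℂ :=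
  detEval (BlockIndex N) (IsNilpotent.exp (detVec (blockShift N z₁ z₂)) *
    IsNilpotent.exp (∑ p : Fin N × (Fin 2 × (Fin 2 × Unit)), (1 : ℂ) •
      (detVec (dualCoeff C p) * detVec (dualCoeffConj C p))))

theorem integral_band {N : ℕ} {W : ℝ} (hW : 0 < W) {C : Matrix (Fin N) (Fin N) ℝ}
    (hC : profile N W = C * Cᵀ) (z₁ z₂ : ℂ) :
    Integrable (fun H => charProd z₁ H * charProd z₂ H) (law N W) ∧
      Theta N W z₁ z₂ = dualValue C z₁ z₂ := by
  have h := (hasGaussianMoments_band N hW).integral_det (blockShift N z₁ z₂) bandCoeff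
    bandCoeffConj
  simp only [det_band] at h
  rw [wick_exponent_eq hC] at h
  rw [Theta, integrable_law_iff hW, integral_law hW]
  simp only [lawDensity_eq, ← mul_assoc]
  refine ⟨h.1.mul_const _, ?_⟩
  rw [integral_mul_const, h.2, dualValue]
  field_simp [normalization_ne_zero hW]

theorem integral_standard {N : ℕ} (C : Matrix (Fin N) (Fin N) ℝ) (z₁ z₂ : ℂ) :
    Integrable (fun G : Fin N → Mat2 => (∏ j, (calQ z₁ z₂ (siteMap C G j)).det) *
      ∏ l, ∏ s, ∏ t, (Real.exp (-‖G l s t‖ ^ 2 / 1) : ℂ)) ∧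
    ∫ G : Fin N → Mat2, (∏ j, (calQ z₁ z₂ (siteMap C G j)).det) *
      ∏ l, ∏ s, ∏ t, (Real.exp (-‖G l s t‖ ^ 2 / 1) : ℂ) =
      (Real.pi : ℂ) ^ (4 * N) * dualValue C z₁ z₂ := by
  have h := (hasGaussianMoments_standard N).integral_det (blockShift N z₁ z₂) (dualCoeff C)
    (dualCoeffConj C)
  simp only [det_dual, Complex.ofReal_one, Finset.prod_const, Finset.card_univ, Fintype.card_fin,
    mul_one, ← pow_mul] at h
  exact h

/-! ### Linear change of variables on the sites -/

theorem siteMap_comp {N : ℕ} (C B : Matrix (Fin N) (Fin N) ℝ) (Q : Fin N → Mat2) :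
    siteMap C (siteMap B Q) = siteMap (C * B) Q := by
  ext j s t
  simp only [siteMap_apply, Finset.mul_sum, Matrix.mul_apply, Complex.ofReal_sum, Finset.sum_mul,
    Complex.ofReal_mul]
  rw [Finset.sum_comm]
  simp only [mul_assoc]

theorem siteMap_one {N : ℕ} (Q : Fin N → Mat2) : siteMap (1 : Matrix (Fin N) (Fin N) ℝ) Q = Q := by
  ext j s t
  rw [siteMap_apply, Finset.sum_eq_single j]
  · simp
  · intro l _ hl; simp [Matrix.one_apply_ne hl.symm]
  · simp

theorem det_siteMap {N : ℕ} (B : Matrix (Fin N) (Fin N) ℝ) :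
    LinearMap.det ((siteMap B).restrictScalars ℝ) = B.det ^ 8 := by
  -- After transposing the indices, `siteMap B` is `B` acting on four copies of `ℂ^N`. The complex
  -- determinant is thus a fourth power, and passing to real scalars squares it.
  let e : (Fin N → Mat2) ≃ₗ[ℂ] (Fin 2 → Fin 2 → Fin N → ℂ) :=
    { toFun := fun Q s t j => Q j s t
      invFun := fun P j s t => P s t j
      map_add' := fun _ _ => rfl
      map_smul' := fun _ _ => rfl
      left_inv := fun _ => rfl
      right_inv := fun _ => rfl }
  have hC : LinearMap.det (siteMap B) = (B.det : ℂ) ^ 4 := by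
    rw [← LinearMap.det_conj (siteMap B) e]
    have : (e : (Fin N → Mat2) →ₗ[ℂ] _) ∘ₗ siteMap B ∘ₗ
        (e.symm : (Fin 2 → Fin 2 → Fin N → ℂ) →ₗ[ℂ] (Fin N → Mat2)) =
        LinearMap.pi fun s : Fin 2 => (LinearMap.pi fun t : Fin 2 =>
          (Matrix.toLin' (B.map Complex.ofReal)).comp (LinearMap.proj t)).comp
            (LinearMap.proj s) := by
      refine LinearMap.ext fun P => ?_
      funext s t j
      simp [e, siteMap_apply, Matrix.mulVec, dotProduct]
    rw [this, LinearMap.det_pi fun _ : Fin 2 => _]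
    simp only [LinearMap.det_pi fun _ : Fin 2 => _, LinearMap.det_toLin', Finset.prod_const,
      Finset.card_univ, Fintype.card_fin]
    rw [← pow_mul]
    congr 1
    exact (RingHom.map_det Complex.ofRealHom B).symm
  rw [LinearMap.det_restrictScalars, hC, map_pow]
  have : Algebra.norm ℝ (B.det : ℂ) = B.det ^ 2 := by
    rw [← Complex.coe_algebraMap, Algebra.norm_algebraMap, Complex.finrank_real_complex]
  rw [this]
  ring

theorem integral_siteMap {N : ℕ} {B : Matrix (Fin N) (Fin N) ℝ} (hB : B.det ≠ 0)
    (F : (Fin N → Mat2) → ℂ) :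
    ∫ Q, F (siteMap B Q) = ((B.det ^ 8)⁻¹ : ℝ) * ∫ G, F G := by
  have hdet : LinearMap.det ((siteMap B).restrictScalars ℝ) ≠ 0 := by
    rw [det_siteMap]; exact pow_ne_zero _ hB
  have h1 : (volume : Measure (Fin 2 → ℂ)).IsAddHaarMeasure :=
    Measure.pi.isAddHaarMeasure fun _ : Fin 2 => (volume : Measure ℂ)
  have h2 : (volume : Measure Mat2).IsAddHaarMeasure :=
    Measure.pi.isAddHaarMeasure fun _ : Fin 2 => (volume : Measure (Fin 2 → ℂ))
  have h3 : (volume : Measure (Fin N → Mat2)).IsAddHaarMeasure :=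
    Measure.pi.isAddHaarMeasure fun _ : Fin N => (volume : Measure Mat2)
  have hmap := Measure.map_linearMap_addHaar_eq_smul_addHaar
    (volume : Measure (Fin N → Mat2)) hdet
  let E := (LinearMap.equivOfDetNeZero _ hdet).toContinuousLinearEquiv
  have hemb : MeasurableEmbedding ((siteMap B).restrictScalars ℝ) :=
    E.toHomeomorph.measurableEmbedding
  have h := hemb.integral_map (μ := volume) F
  rw [hmap, integral_smul_measure, det_siteMap, ENNReal.toReal_ofReal (abs_nonneg _),
    abs_of_nonneg (inv_nonneg.2 (by positivity : 0 ≤ B.det ^ 8)), Complex.real_smul] at h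
  exact h.symm

/-! ### The function `g` -/

theorem trSq_eq (A : Mat2) : trSq A = ∑ s, ∑ t, ‖A s t‖ ^ 2 := by
  simp only [trSq, Matrix.trace, Matrix.diag, Matrix.mul_apply, Matrix.conjTranspose_apply,
    Matrix.of_apply, Complex.re_sum, RCLike.star_def, Complex.mul_conj, Complex.ofReal_re,
    Complex.normSq_eq_norm_sq]

theorem trSq_nonneg (A : Mat2) : 0 ≤ trSq A := by
  rw [trSq_eq]
  positivity

theorem continuous_trSq : Continuous trSq := by
  simp only [funext trSq_eq]
  fun_prop

theorem continuous_det_calQ (z₁ z₂ : ℂ) : Continuous fun Q : Mat2 => (calQ z₁ z₂ Q).det := by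
  refine Continuous.matrix_det (continuous_matrix fun a b => ?_)
  rcases a with a | a <;> rcases b with b | b <;>
  simp only [calQ, Matrix.fromBlocks_apply₁₁, Matrix.fromBlocks_apply₁₂,
    Matrix.fromBlocks_apply₂₁, Matrix.fromBlocks_apply₂₂, Matrix.smul_apply, Matrix.of_apply,
    Matrix.conjTranspose_apply, RCLike.star_def] <;>
  fun_prop

theorem g_sq (N : ℕ) (z ζ : ℂ) (Q : Mat2) :
    g N z ζ Q ^ 2 = Complex.exp (2 * (uStar z : ℂ) ^ 2) *
      ((calQ (zOne N z ζ) (zTwo N z ζ) Q).det * Complex.exp (-(trSq Q : ℂ))) := by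
  unfold g
  split_ifs with h
  · simp [h]
  · rw [← Complex.exp_nat_mul]
    have : ((2 : ℕ) : ℂ) * f N z ζ Q = 2 * (uStar z : ℂ) ^ 2 +
        (Complex.log (calQ (zOne N z ζ) (zTwo N z ζ) Q).det + -(trSq Q : ℂ)) := by
      unfold f
      push_cast
      ring
    rw [this, Complex.exp_add, Complex.exp_add, Complex.exp_log h]

theorem measurable_g (N : ℕ) (z ζ : ℂ) : Measurable (g N z ζ) := by
  have hd := (continuous_det_calQ (zOne N z ζ) (zTwo N z ζ)).measurable
  have ht := continuous_trSq.measurable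
  refine Measurable.ite (hd (measurableSet_singleton 0)) measurable_const ?_
  unfold f
  fun_prop

theorem prod_exp_eq (Q : Mat2) :
    ∏ s, ∏ t, (Real.exp (-‖Q s t‖ ^ 2 / 1) : ℂ) = Complex.exp (-(trSq Q : ℂ)) := by
  have : ∏ s, ∏ t, Real.exp (-‖Q s t‖ ^ 2 / 1) = Real.exp (-trSq Q) := by
    simp only [trSq_eq, div_one, ← Real.exp_sum, Finset.sum_neg_distrib]
  exact_mod_cast congrArg Complex.ofReal this

/-- The one-site case of the Gaussian determinant formula; together with `g_sq` it puts `g` in `L₂`.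
-/
theorem integrable_det_calQ (z₁ z₂ : ℂ) :
    Integrable fun Q : Mat2 => (calQ z₁ z₂ Q).det * Complex.exp (-(trSq Q : ℂ)) := by
  have h := (hasGaussianMoments_mat2.integral_det (calQ z₁ z₂ 0)
    (fun p => Matrix.single (Sum.inl p.1) (Sum.inr p.2.1) Complex.I)
    (fun p => Matrix.single (Sum.inr p.2.1) (Sum.inl p.1) Complex.I)).1
  simp only [prod_exp_eq] at h
  convert h using 4 with Q
  ext a b
  rcases a with a | a <;> rcases b with b | b <;> fin_cases a <;> fin_cases b <;>
  simp [calQ, Fintype.sum_prod_type, mul_comm]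

theorem memLp_g (N : ℕ) (z ζ : ℂ) : MemLp (g N z ζ) 2 (volume : Measure Mat2) := by
  rw [memLp_two_iff_integrable_sq_norm (measurable_g N z ζ).aestronglyMeasurable]
  simp only [← norm_pow, g_sq]
  exact ((integrable_det_calQ _ _).const_mul _).norm

/-- Only the off-diagonal entries of `Q` bring in non-real coefficients, through `z₁ * conj z₂`. If
that number is real and nonnegative, so is the determinant, and `g` is real. -/
theorem det_calQ (z₁ z₂ : ℂ) (Q : Mat2) :
    (calQ z₁ z₂ Q).det = ((‖z₁‖ ^ 2 * ‖z₂‖ ^ 2 + ‖Q 0 0 * Q 1 1 - Q 0 1 * Q 1 0‖ ^ 2 +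
      ‖Q 0 0‖ ^ 2 * ‖z₂‖ ^ 2 + ‖Q 1 1‖ ^ 2 * ‖z₁‖ ^ 2 : ℝ) : ℂ) +
      (‖Q 0 1‖ ^ 2 : ℝ) * conj (z₁ * conj z₂) + (‖Q 1 0‖ ^ 2 : ℝ) * (z₁ * conj z₂) := by
  have h1 : (calQ z₁ z₂ Q).det =
      !![z₁, 0, Complex.I * Q 0 0, Complex.I * Q 0 1;
        0, z₂, Complex.I * Q 1 0, Complex.I * Q 1 1;
        Complex.I * conj (Q 0 0), Complex.I * conj (Q 1 0), conj z₁, 0;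
        Complex.I * conj (Q 0 1), Complex.I * conj (Q 1 1), 0, conj z₂].det := by
    rw [← Matrix.det_reindex_self finSumFinEquiv]
    congr 1
    ext i j
    fin_cases i <;> fin_cases j <;> simp [calQ, finSumFinEquiv, Fin.addCases]
  rw [h1]
  have hn : ∀ x : ℂ, ((‖x‖ ^ 2 : ℝ) : ℂ) = x * conj x := fun x => by
    rw [← Complex.normSq_eq_norm_sq, Complex.mul_conj]
  push_cast at hn
  push_cast
  simp only [hn, map_sub, map_mul, Complex.conj_conj]
  simp [Matrix.det_succ_row_zero, Fin.sum_univ_succ, Fin.succAbove]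
  linear_combination ((Q 0 0 * Q 1 1 - Q 0 1 * Q 1 0) *
    (conj (Q 0 0) * conj (Q 1 1) - conj (Q 0 1) * conj (Q 1 0)) * (Complex.I ^ 2 - 1) -
    (Q 0 0 * conj (Q 0 0) * (z₂ * conj z₂) + Q 1 1 * conj (Q 1 1) * (z₁ * conj z₁) +
      Q 0 1 * conj (Q 0 1) * (conj z₁ * z₂) + Q 1 0 * conj (Q 1 0) * (z₁ * conj z₂))) * Complex.I_sq

theorem conj_g {N : ℕ} {z ζ : ℂ} (him : (zOne N z ζ * conj (zTwo N z ζ)).im = 0)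
    (hre : 0 ≤ (zOne N z ζ * conj (zTwo N z ζ)).re) (Q : Mat2) :
    conj (g N z ζ Q) = g N z ζ Q := by
  obtain ⟨r, hr, hz⟩ : ∃ r : ℝ, 0 ≤ r ∧ zOne N z ζ * conj (zTwo N z ζ) = r :=
    ⟨_, hre, Complex.ext rfl (by simp [him])⟩
  obtain ⟨d, hd, hdet⟩ : ∃ d : ℝ, 0 ≤ d ∧ (calQ (zOne N z ζ) (zTwo N z ζ) Q).det = d := by
    rw [det_calQ, hz, Complex.conj_ofReal, ← Complex.ofReal_mul, ← Complex.ofReal_mul,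
      ← Complex.ofReal_add, ← Complex.ofReal_add]
    exact ⟨_, by positivity, rfl⟩
  have hf : f N z ζ Q = ((1 / 2 * (-trSq Q + Real.log d + 2 * uStar z ^ 2) : ℝ) : ℂ) := by
    rw [f, hdet, ← Complex.ofReal_log hd]
    push_cast
    ring
  unfold g
  split_ifs
  · simp
  · rw [hf, ← Complex.ofReal_exp, Complex.conj_ofReal]

/-! ### The chain integral -/

theorem prod_consecutive {M : Type*} [CommMonoid M] {m : ℕ} (a : Fin (m + 1) → M) :
    a 0 * (∏ i : Fin m, a i.castSucc * a i.succ) * a (Fin.last m) = ∏ j, a j ^ 2 := by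
  rw [Finset.prod_pow, sq]
  nth_rw 1 [Fin.prod_univ_succ]
  rw [Fin.prod_univ_castSucc, Finset.prod_mul_distrib]
  simp only [mul_assoc, mul_left_comm, mul_comm]

theorem chainIntegrand_eq (N : ℕ) (hN : 0 < N) (W : ℝ) (z ζ : ℂ) (Q : Fin N → Mat2) :
    chainIntegrand N hN W z ζ Q =
      ((∏ i : Fin (N - 1), (Real.pi ^ 4 * W ^ 4 * (lambdaStar W z ^ 2)⁻¹ *
        Real.exp (-W ^ 2 * trSq (Q ⟨i, by have := i.isLt; omega⟩ -
          Q ⟨i + 1, by have := i.isLt; omega⟩))) : ℝ) : ℂ) * ∏ j, g N z ζ (Q j) ^ 2 := by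
  obtain ⟨m, rfl⟩ : ∃ m, N = m + 1 := ⟨N - 1, by omega⟩
  rw [← prod_consecutive fun j => g (m + 1) z ζ (Q j)]
  simp only [chainIntegrand, kernel]
  rw [Finset.prod_mul_distrib, Complex.ofReal_prod]
  change g (m + 1) z ζ (Q 0) * (_ * ∏ i : Fin m, g (m + 1) z ζ (Q i.castSucc) *
    g (m + 1) z ζ (Q i.succ)) * g (m + 1) z ζ (Q (Fin.last m)) = _
  ring

theorem prod_exp_siteMap {N : ℕ} {W : ℝ} {B : Matrix (Fin N) (Fin N) ℝ}
    (hB : precision N W = Bᵀ * B) (Q : Fin N → Mat2) :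
    ∏ l, ∏ s, ∏ t, (Real.exp (-‖siteMap B Q l s t‖ ^ 2 / 1) : ℂ) =
      ((Real.exp (-((∑ j, trSq (Q j)) + W ^ 2 * ∑ i : Fin (N - 1),
        trSq (Q ⟨i, by have := i.isLt; omega⟩ -
          Q ⟨i + 1, by have := i.isLt; omega⟩))) : ℝ) : ℂ) := by
  have h : ∀ s t, ∑ l, ‖siteMap B Q l s t‖ ^ 2 = (∑ j, ‖Q j s t‖ ^ 2) +
      W ^ 2 * ∑ i : Fin (N - 1), ‖Q ⟨i, by have := i.isLt; omega⟩ s t -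
        Q ⟨i + 1, by have := i.isLt; omega⟩ s t‖ ^ 2 := by
    intro s t
    have h1 := quadForm_precision W fun j => Q j s t
    rw [hB, quadForm_conjTranspose_mul] at h1
    simp only [siteMap_apply]
    exact_mod_cast h1
  have h2 : ∑ l, trSq (siteMap B Q l) = (∑ j, trSq (Q j)) + W ^ 2 * ∑ i : Fin (N - 1),
      trSq (Q ⟨i, by have := i.isLt; omega⟩ - Q ⟨i + 1, by have := i.isLt; omega⟩) := by
    have hc : ∀ (n : ℕ) (F : Fin n → Fin 2 → Fin 2 → ℝ),
        ∑ l, ∑ s, ∑ t, F l s t = ∑ s, ∑ t, ∑ l, F l s t := by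
      intro n F
      rw [Finset.sum_comm]
      exact Finset.sum_congr rfl fun s _ => Finset.sum_comm
    simp only [trSq_eq, hc, h, Finset.sum_add_distrib, Finset.mul_sum, Pi.sub_apply]
  rw [← h2]
  simp only [prod_exp_eq]
  rw [← Complex.exp_sum, Finset.sum_neg_distrib]
  push_cast
  rfl

theorem thetaTilde_eq_integral (N : ℕ) (hN : 0 < N) {W : ℝ} (hW : 0 < W) (z ζ : ℂ) :
    ThetaTilde N W z ζ = ∫ Q, chainIntegrand N hN W z ζ Q := by
  obtain ⟨B, hB, hdet⟩ := exists_precision_eq N W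
  have hu : IsUnit B.det := hdet.isUnit
  have hC : profile N W = B⁻¹ * B⁻¹ᵀ := by
    rw [profile_eq, hB, Matrix.mul_inv_rev, Matrix.transpose_nonsing_inv]
  -- This is exactly the Jacobian of `siteMap B`, so the factor `det J` in `normConst` cancels it.
  have hdetJ : (profile N W).det ^ 4 = (B.det ^ 8)⁻¹ := by
    rw [hC, Matrix.det_mul, Matrix.det_transpose, Matrix.det_nonsing_inv, Ring.inverse_eq_inv']
    ring
  have hcv := integral_siteMap hdet fun G =>
    (∏ j, (calQ (zOne N z ζ) (zTwo N z ζ) (siteMap B⁻¹ G j)).det) *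
      ∏ l, ∏ s, ∏ t, (Real.exp (-‖G l s t‖ ^ 2 / 1) : ℂ)
  rw [(integral_standard _ _ _).2] at hcv
  simp only [siteMap_comp, Matrix.nonsing_inv_mul B hu, siteMap_one, prod_exp_siteMap hB] at hcv
  have hchain : ∀ Q : Fin N → Mat2, chainIntegrand N hN W z ζ Q =
      (((Real.pi ^ 4 * W ^ 4 * (lambdaStar W z ^ 2)⁻¹) ^ (N - 1) *
        Real.exp (2 * uStar z ^ 2) ^ N : ℝ) : ℂ) *
      ((∏ j, (calQ (zOne N z ζ) (zTwo N z ζ) (Q j)).det) *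
        ((Real.exp (-((∑ j, trSq (Q j)) + W ^ 2 * ∑ i : Fin (N - 1),
        trSq (Q ⟨i, by have := i.isLt; omega⟩ -
          Q ⟨i + 1, by have := i.isLt; omega⟩))) : ℝ) : ℂ)) := by
    intro Q
    rw [chainIntegrand_eq]
    simp only [g_sq, Finset.prod_mul_distrib, Finset.prod_const, Finset.card_univ, Fintype.card_fin,
      neg_add, Real.exp_add, ← Real.exp_sum, ← Complex.exp_sum, Finset.sum_neg_distrib,
      ← Finset.mul_sum]
    push_cast
    rw [neg_mul]
    ring
  simp only [hchain]
  rw [integral_const_mul, hcv, ThetaTilde, (integral_band hW hC _ _).2, normConst, hdetJ]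
  have hpi : (Real.pi : ℂ) ≠ 0 := by exact_mod_cast Real.pi_ne_zero
  have hBd : (B.det : ℂ) ≠ 0 := by exact_mod_cast hdet
  have he : Real.exp (-2 * N * uStar z ^ 2) = (Real.exp (2 * uStar z ^ 2) ^ N)⁻¹ := by
    rw [← Real.exp_nat_mul, ← Real.exp_neg]
    congr 1
    ring
  have hk : (Real.pi ^ 2 * W ^ 2 * (lambdaStar W z)⁻¹) ^ (2 * (N - 1)) =
      (Real.pi ^ 4 * W ^ 4 * (lambdaStar W z ^ 2)⁻¹) ^ (N - 1) := by
    rw [pow_mul]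
    congr 1
    ring
  rw [he, hk]
  simp only [mul_inv, inv_inv]
  push_cast
  ring

/-! ### Integral operators with product bounds -/

section IntegralOperator

variable {X : Type*} [MeasureSpace X] {k : X → X → ℂ} {φ : X → ℂ} {c : ℝ}

theorem integrable_norm_mul_norm {u v : X → ℂ} (hu : MemLp u 2) (hv : MemLp v 2) :
    Integrable fun x => ‖u x‖ * ‖v x‖ :=
  hu.norm.integrable_mul hv.norm

/-- Cauchy–Schwarz in the real `L₂` space, applied to the pointwise norms. -/
theorem integral_norm_mul_norm_le (u v : Lp ℂ 2 (volume : Measure X)) :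
    ∫ x, ‖u x‖ * ‖v x‖ ≤ ‖u‖ * ‖v‖ := by
  have h := real_inner_le_norm ((Lp.memLp u).norm.toLp _) ((Lp.memLp v).norm.toLp _)
  rw [L2.inner_def, Lp.norm_toLp, Lp.norm_toLp, eLpNorm_norm, eLpNorm_norm, ← Lp.norm_def,
    ← Lp.norm_def] at h
  refine le_trans (le_of_eq (integral_congr_ae ?_)) h
  filter_upwards [(Lp.memLp u).norm.coeFn_toLp, (Lp.memLp v).norm.coeFn_toLp] with x h1 h2
  rw [h1, h2]
  simp [mul_comm]

theorem integrable_kernel_mul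
    (hk : Measurable (Function.uncurry k)) (hφ : MemLp φ 2)
    (hb : ∀ x y, ‖k x y‖ ≤ c * (‖φ x‖ * ‖φ y‖))
    {u : X → ℂ} (hu : MemLp u 2) (x : X) :
    Integrable fun y => k x y * u y := by
  refine Integrable.mono' ((integrable_norm_mul_norm hφ hu).const_mul (c * ‖φ x‖))
    ((hk.comp measurable_prodMk_left).aestronglyMeasurable.mul hu.1)
    (Filter.Eventually.of_forall fun y => ?_)
  rw [norm_mul]
  calc ‖k x y‖ * ‖u y‖ ≤ c * (‖φ x‖ * ‖φ y‖) * ‖u y‖ :=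
        mul_le_mul_of_nonneg_right (hb x y) (norm_nonneg _)
    _ = c * ‖φ x‖ * (‖φ y‖ * ‖u y‖) := by ring

theorem norm_integral_kernel_mul_le
    (hφ : MemLp φ 2)
    (hb : ∀ x y, ‖k x y‖ ≤ c * (‖φ x‖ * ‖φ y‖))
    {u : X → ℂ} (hu : MemLp u 2) (x : X) :
    ‖∫ y, k x y * u y‖ ≤ c * (∫ y, ‖φ y‖ * ‖u y‖) * ‖φ x‖ := by
  refine (norm_integral_le_of_norm_le
    ((integrable_norm_mul_norm hφ hu).const_mul (c * ‖φ x‖))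
    (Filter.Eventually.of_forall fun y => ?_)).trans (le_of_eq ?_)
  · rw [norm_mul]
    calc ‖k x y‖ * ‖u y‖ ≤ c * (‖φ x‖ * ‖φ y‖) * ‖u y‖ :=
          mul_le_mul_of_nonneg_right (hb x y) (norm_nonneg _)
      _ = c * ‖φ x‖ * (‖φ y‖ * ‖u y‖) := by ring
  · rw [integral_const_mul]
    ring

theorem memLp_integral_kernel_mul [SigmaFinite (volume : Measure X)]
    (hk : Measurable (Function.uncurry k)) (hφ : MemLp φ 2)
    (hb : ∀ x y, ‖k x y‖ ≤ c * (‖φ x‖ * ‖φ y‖))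
    {u : X → ℂ} (hu : MemLp u 2) :
    MemLp (fun x => ∫ y, k x y * u y) 2 := by
  refine MemLp.of_le_mul hφ ?_ (Filter.Eventually.of_forall
    fun x => norm_integral_kernel_mul_le hφ hb hu x)
  exact AEStronglyMeasurable.integral_prod_right'
    (f := fun p : X × X => k p.1 p.2 * u p.2)
    (hk.aestronglyMeasurable.mul hu.1.comp_snd)

/-- A kernel bounded by `c φ ⊗ φ` with `φ` square integrable defines a bounded operator. -/
theorem exists_integralOperator [SigmaFinite (volume : Measure X)]
    (hk : Measurable (Function.uncurry k)) (hφ : MemLp φ 2)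
    (hb : ∀ x y, ‖k x y‖ ≤ c * (‖φ x‖ * ‖φ y‖))
    (hc : 0 ≤ c) :
    ∃ T : Lp ℂ 2 (volume : Measure X) →L[ℂ] Lp ℂ 2 (volume : Measure X),
      ∀ u, (T u : X → ℂ) =ᵐ[volume] fun x => ∫ y, k x y * u y := by
  have hm := fun u : Lp ℂ 2 (volume : Measure X) =>
    memLp_integral_kernel_mul hk hφ hb (Lp.memLp u)
  let L : Lp ℂ 2 (volume : Measure X) →ₗ[ℂ] Lp ℂ 2 (volume : Measure X) :=
    { toFun := fun u => (hm u).toLp _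
      map_add' := by
        intro u v
        rw [← MemLp.toLp_add]
        refine MemLp.toLp_congr _ _ (Filter.Eventually.of_forall fun x => ?_)
        simp only [Pi.add_apply]
        rw [← integral_add (integrable_kernel_mul hk hφ hb (Lp.memLp u) x)
          (integrable_kernel_mul hk hφ hb (Lp.memLp v) x)]
        refine integral_congr_ae ?_
        filter_upwards [Lp.coeFn_add u v] with y hy
        rw [hy, Pi.add_apply, mul_add]
      map_smul' := by
        intro a u
        rw [RingHom.id_apply, ← MemLp.toLp_const_smul]
        refine MemLp.toLp_congr _ _ (Filter.Eventually.of_forall fun x => ?_)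
        simp only [Pi.smul_apply, smul_eq_mul]
        rw [← integral_const_mul]
        refine integral_congr_ae ?_
        filter_upwards [Lp.coeFn_smul a u] with y hy
        rw [hy, Pi.smul_apply, smul_eq_mul, mul_left_comm] }
  refine ⟨L.mkContinuous (c * ‖hφ.toLp φ‖ * ‖hφ.toLp φ‖) fun u => ?_, fun u => (hm u).coeFn_toLp⟩
  have h1 : ‖L u‖ ≤ c * (∫ y, ‖φ y‖ * ‖u y‖) * ‖hφ.toLp φ‖ := by
    refine Lp.norm_le_mul_norm_of_ae_le_mul ?_
    filter_upwards [(hm u).coeFn_toLp, hφ.coeFn_toLp] with x hx1 hx2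
    rw [hx2]
    exact (congrArg norm hx1).le.trans (norm_integral_kernel_mul_le hφ hb (Lp.memLp u) x)
  have h2 : ∫ y, ‖φ y‖ * ‖u y‖ ≤ ‖hφ.toLp φ‖ * ‖u‖ := by
    refine le_trans (le_of_eq (integral_congr_ae ?_)) (integral_norm_mul_norm_le (hφ.toLp φ) u)
    filter_upwards [hφ.coeFn_toLp] with y hy
    rw [hy]
  calc ‖L u‖ ≤ c * (∫ y, ‖φ y‖ * ‖u y‖) * ‖hφ.toLp φ‖ := h1
    _ ≤ c * (‖hφ.toLp φ‖ * ‖u‖) * ‖hφ.toLp φ‖ := by gcongr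
    _ = c * ‖hφ.toLp φ‖ * ‖hφ.toLp φ‖ * ‖u‖ := by ring

/-! ### Iterated kernels -/

/-- The iterates of the integral operator with kernel `k` applied to `φ`. -/
def iterKernel (k : X → X → ℂ) (φ : X → ℂ) : ℕ → X → ℂ
  | 0 => φ
  | m + 1 => fun x => ∫ y, k x y * iterKernel k φ m y

/-- Powers of `T` give only classes modulo null sets; `iterKernel` supplies representatives defined
at every point, to which Fubini applies. -/
theorem pow_toLp_ae_eq {T : Lp ℂ 2 (volume : Measure X) →L[ℂ] Lp ℂ 2 (volume : Measure X)}
    (hT : ∀ u, (T u : X → ℂ) =ᵐ[volume] fun x => ∫ y, k x y * u y) (hφ : MemLp φ 2) (m : ℕ) :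
    ((T ^ m) (hφ.toLp φ) : X → ℂ) =ᵐ[volume] iterKernel k φ m := by
  induction m with
  | zero => exact hφ.coeFn_toLp
  | succ m ih =>
    rw [pow_succ']
    refine (hT ((T ^ m) (hφ.toLp φ))).trans (Filter.Eventually.of_forall fun x => ?_)
    refine integral_congr_ae ?_
    filter_upwards [ih] with y hy
    rw [hy]

/-- The product of the kernels along a path, closed by `φ` at the last point. -/
def pathWeight (k : X → X → ℂ) (φ : X → ℂ) (m : ℕ) (Q : Fin (m + 1) → X) : ℂ :=
  (∏ i : Fin m, k (Q i.castSucc) (Q i.succ)) * φ (Q (Fin.last m))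

theorem pathWeight_cons (m : ℕ) (x : X) (Q : Fin (m + 1) → X) :
    pathWeight k φ (m + 1) (Fin.cons x Q) = k x (Q 0) * pathWeight k φ m Q := by
  rw [pathWeight, pathWeight, Fin.prod_univ_succ, ← mul_assoc]
  rfl

theorem measurable_pathWeight
    (hk : Measurable (Function.uncurry k))
    (hm : Measurable φ) (m : ℕ) : Measurable (pathWeight k φ m) := by
  unfold pathWeight
  refine (Finset.measurable_prod _ fun i _ => ?_).mul (hm.comp (measurable_pi_apply _))
  have h : Measurable fun Q : Fin (m + 1) → X => (Q i.castSucc, Q i.succ) := by fun_prop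
  exact hk.comp h

/-- Each kernel contributes `‖φ‖` at both of its ends and the two outer factors complete the end
points, so every site receives `‖φ‖ ^ 2`: an integrable product bound. -/
theorem norm_mul_pathWeight_le
    (hb : ∀ x y, ‖k x y‖ ≤ c * (‖φ x‖ * ‖φ y‖))
    (m : ℕ) (Q : Fin (m + 1) → X) :
    ‖φ (Q 0) * pathWeight k φ m Q‖ ≤ c ^ m * ∏ j, ‖φ (Q j)‖ ^ 2 := by
  rw [← prod_consecutive, pathWeight, norm_mul, norm_mul, norm_prod, ← mul_assoc]
  have h : ∏ i : Fin m, ‖k (Q i.castSucc) (Q i.succ)‖ ≤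
      c ^ m * ∏ i : Fin m, ‖φ (Q i.castSucc)‖ * ‖φ (Q i.succ)‖ := by
    refine (Finset.prod_le_prod (fun i _ => norm_nonneg _) fun i _ => hb _ _).trans (le_of_eq ?_)
    rw [Finset.prod_mul_distrib]
    simp
  calc _ ≤ ‖φ (Q 0)‖ * (c ^ m * ∏ i : Fin m, ‖φ (Q i.castSucc)‖ * ‖φ (Q i.succ)‖) *
        ‖φ (Q (Fin.last m))‖ := by gcongr
    _ = _ := by ring

theorem integrable_prod_sq [SigmaFinite (volume : Measure X)]
    (hφ : MemLp φ 2)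
    (m : ℕ) :
    Integrable fun Q : Fin m → X => ∏ j, ‖φ (Q j)‖ ^ 2 :=
  Integrable.fintype_prod (f := fun _ x => ‖φ x‖ ^ 2)
    fun _ => (memLp_two_iff_integrable_sq_norm hφ.1).1 hφ

theorem integrable_mul_pathWeight [SigmaFinite (volume : Measure X)]
    (hk : Measurable (Function.uncurry k)) (hφ : MemLp φ 2)
    (hb : ∀ x y, ‖k x y‖ ≤ c * (‖φ x‖ * ‖φ y‖))
    (hm : Measurable φ) (m : ℕ) :
    Integrable fun Q : Fin (m + 1) → X => φ (Q 0) * pathWeight k φ m Q :=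
  ((integrable_prod_sq hφ (m + 1)).const_mul (c ^ m)).mono'
    ((hm.comp (measurable_pi_apply _)).mul (measurable_pathWeight hk hm m)).aestronglyMeasurable
    (Filter.Eventually.of_forall fun Q => norm_mul_pathWeight_le hb m Q)

theorem integrable_kernel_mul_pathWeight [SigmaFinite (volume : Measure X)]
    (hk : Measurable (Function.uncurry k)) (hφ : MemLp φ 2)
    (hb : ∀ x y, ‖k x y‖ ≤ c * (‖φ x‖ * ‖φ y‖))
    (hm : Measurable φ) (hc : 0 ≤ c) (m : ℕ) (x : X) :
    Integrable fun Q : Fin (m + 1) → X => k x (Q 0) * pathWeight k φ m Q := by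
  refine ((integrable_prod_sq hφ (m + 1)).const_mul (c * ‖φ x‖ * c ^ m)).mono'
    (((hk.comp measurable_prodMk_left).comp (measurable_pi_apply _)).mul
      (measurable_pathWeight hk hm m)).aestronglyMeasurable
    (Filter.Eventually.of_forall fun Q => ?_)
  have h := norm_mul_pathWeight_le hb m Q
  rw [norm_mul] at h ⊢
  calc ‖k x (Q 0)‖ * ‖pathWeight k φ m Q‖
      ≤ c * (‖φ x‖ * ‖φ (Q 0)‖) * ‖pathWeight k φ m Q‖ :=
        mul_le_mul_of_nonneg_right (hb _ _) (norm_nonneg _)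
    _ = c * ‖φ x‖ * (‖φ (Q 0)‖ * ‖pathWeight k φ m Q‖) := by ring
    _ ≤ c * ‖φ x‖ * (c ^ m * ∏ j, ‖φ (Q j)‖ ^ 2) := by gcongr
    _ = _ := by ring

theorem integral_fin_cons [SigmaFinite (volume : Measure X)] {m : ℕ}
    {F : (Fin (m + 1) → X) → ℂ} (hF : Integrable F) :
    ∫ Q, F Q = ∫ x, ∫ y : Fin m → X, F (Fin.cons x y) := by
  have hp := (volume_preserving_piFinSuccAbove (fun _ : Fin (m + 1) => X) 0).symm
  have he : ∀ p : X × (Fin m → X),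
      (MeasurableEquiv.piFinSuccAbove (fun _ : Fin (m + 1) => X) 0).symm p = Fin.cons p.1 p.2 := by
    intro p
    simp [MeasurableEquiv.piFinSuccAbove_symm_apply, Fin.insertNthEquiv]
  have hI := (hp.integrable_comp_emb (MeasurableEquiv.measurableEmbedding _)).2 hF
  rw [← hp.integral_comp', Measure.volume_eq_prod]
  refine (integral_prod _ hI).trans ?_
  simp only [Function.comp_apply, he]

theorem iterKernel_eq [SigmaFinite (volume : Measure X)]
    (hk : Measurable (Function.uncurry k)) (hφ : MemLp φ 2)
    (hb : ∀ x y, ‖k x y‖ ≤ c * (‖φ x‖ * ‖φ y‖))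
    (hm : Measurable φ) (hc : 0 ≤ c) (m : ℕ) (x : X) :
    iterKernel k φ m x = ∫ y : Fin m → X, pathWeight k φ m (Fin.cons x y) := by
  induction m generalizing x with
  | zero =>
    -- The space `Fin 0 → X` is one point of mass one.
    simp [iterKernel, pathWeight, Measure.real, volume_pi]
  | succ m ih =>
    simp only [iterKernel, pathWeight_cons, ih]
    rw [integral_fin_cons (integrable_kernel_mul_pathWeight hk hφ hb hm hc m x)]
    simp only [Fin.cons_zero, integral_const_mul]

theorem integral_pow_toLp_mul [SigmaFinite (volume : Measure X)]
    (hk : Measurable (Function.uncurry k)) (hφ : MemLp φ 2)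
    (hb : ∀ x y, ‖k x y‖ ≤ c * (‖φ x‖ * ‖φ y‖))
    (hm : Measurable φ) (hc : 0 ≤ c)
    {T : Lp ℂ 2 (volume : Measure X) →L[ℂ] Lp ℂ 2 (volume : Measure X)}
    (hT : ∀ u, (T u : X → ℂ) =ᵐ[volume] fun x => ∫ y, k x y * u y) (m : ℕ) :
    ∫ x, (T ^ m) (hφ.toLp φ) x * φ x =
      ∫ Q : Fin (m + 1) → X, φ (Q 0) * pathWeight k φ m Q := by
  rw [integral_fin_cons (integrable_mul_pathWeight hk hφ hb hm m)]
  refine integral_congr_ae ?_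
  filter_upwards [pow_toLp_ae_eq hT hφ m] with x hx
  simp only [Fin.cons_zero, integral_const_mul]
  rw [hx, iterKernel_eq hk hφ hb hm hc, mul_comm]

end IntegralOperator

/-! ### The transfer kernel as an instance of the product bound -/

theorem norm_kernel_le (N : ℕ) (W : ℝ) (z ζ : ℂ) (Q Q' : Mat2) :
    ‖kernel N W z ζ Q Q'‖ ≤
      Real.pi ^ 4 * W ^ 4 * (lambdaStar W z ^ 2)⁻¹ * (‖g N z ζ Q‖ * ‖g N z ζ Q'‖) := by
  have hpos : 0 ≤ Real.pi ^ 4 * W ^ 4 * (lambdaStar W z ^ 2)⁻¹ := by positivity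
  rw [kernel, norm_mul, norm_mul, Complex.norm_real, Real.norm_of_nonneg (by positivity)]
  refine mul_le_mul_of_nonneg_right (mul_le_of_le_one_right hpos (Real.exp_le_one_iff.2 ?_))
    (by positivity)
  rw [neg_mul]
  exact neg_nonpos.2 (mul_nonneg (sq_nonneg _) (trSq_nonneg _))

theorem measurable_kernel (N : ℕ) (W : ℝ) (z ζ : ℂ) :
    Measurable (Function.uncurry (kernel N W z ζ)) := by
  have ht := continuous_trSq.measurable
  have hg := measurable_g N z ζ
  have h1 : Measurable fun p : Mat2 × Mat2 => trSq (p.1 - p.2) :=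
    ht.comp (measurable_fst.sub measurable_snd)
  have h2 : Measurable fun p : Mat2 × Mat2 => g N z ζ p.1 := hg.comp measurable_fst
  have h3 : Measurable fun p : Mat2 × Mat2 => g N z ζ p.2 := hg.comp measurable_snd
  change Measurable fun p : Mat2 × Mat2 => kernel N W z ζ p.1 p.2
  unfold kernel
  fun_prop

theorem chainIntegrand_succ (m : ℕ) (hm : 0 < m + 1) (W : ℝ) (z ζ : ℂ) (Q : Fin (m + 1) → Mat2) :
    chainIntegrand (m + 1) hm W z ζ Q =
      g (m + 1) z ζ (Q 0) * pathWeight (kernel (m + 1) W z ζ) (g (m + 1) z ζ) m Q := by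
  rw [chainIntegrand, mul_assoc]
  rfl

end BandMatrix

end

/-- The pairing `(𝒦^{N-1} g, g)` is the bilinear one, `∫ (𝒦^{N-1} g) g dQ`. When `z₁ z̄₂ ≥ 0`, the
function `g` is real and the pairing is the inner product of `L₂(H₂)`. -/
theorem proposition2p1 (N : ℕ) (hN : 0 < N) (W : ℝ) (hW : 0 < W) (z ζ : ℂ) (hz : ‖z‖ < 1) :
    IsProbabilityMeasure (BandMatrix.law N W) ∧
    Integrable (fun H => BandMatrix.charProd (BandMatrix.zOne N z ζ) H *
      BandMatrix.charProd (BandMatrix.zTwo N z ζ) H) (BandMatrix.law N W) ∧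
    Integrable (BandMatrix.chainIntegrand N hN W z ζ) ∧
    BandMatrix.ThetaTilde N W z ζ = ∫ Q, BandMatrix.chainIntegrand N hN W z ζ Q ∧
    ∃ (K : BandMatrix.L2Mat2 →L[ℂ] BandMatrix.L2Mat2)
      (hg : MemLp (BandMatrix.g N z ζ) 2 (volume : Measure BandMatrix.Mat2)),
      BandMatrix.IsIntegralOperator K (BandMatrix.kernel N W z ζ) ∧
      BandMatrix.ThetaTilde N W z ζ =
        ∫ Q, ((K ^ (N - 1)) (hg.toLp (BandMatrix.g N z ζ))) Q * BandMatrix.g N z ζ Q ∧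
      ((BandMatrix.zOne N z ζ * conj (BandMatrix.zTwo N z ζ)).im = 0 →
        0 ≤ (BandMatrix.zOne N z ζ * conj (BandMatrix.zTwo N z ζ)).re →
        BandMatrix.ThetaTilde N W z ζ =
          inner ℂ (hg.toLp (BandMatrix.g N z ζ))
            ((K ^ (N - 1)) (hg.toLp (BandMatrix.g N z ζ)))) := by
  obtain ⟨B, hB, -⟩ := BandMatrix.exists_precision_eq N W
  have hC : BandMatrix.profile N W = B⁻¹ * B⁻¹ᵀ := by
    rw [BandMatrix.profile_eq, hB, Matrix.mul_inv_rev, Matrix.transpose_nonsing_inv]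
  have hg := BandMatrix.memLp_g N z ζ
  have hgm := BandMatrix.measurable_g N z ζ
  have hk := BandMatrix.measurable_kernel N W z ζ
  have hb := BandMatrix.norm_kernel_le N W z ζ
  have hc : 0 ≤ Real.pi ^ 4 * W ^ 4 * (BandMatrix.lambdaStar W z ^ 2)⁻¹ := by positivity
  obtain ⟨K, hK⟩ := BandMatrix.exists_integralOperator hk hg hb hc
  have hchain := BandMatrix.thetaTilde_eq_integral N hN hW z ζ
  have hpair : BandMatrix.ThetaTilde N W z ζ =
      ∫ Q, ((K ^ (N - 1)) (hg.toLp (BandMatrix.g N z ζ))) Q * BandMatrix.g N z ζ Q := by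
    rw [hchain]
    obtain ⟨m, rfl⟩ : ∃ m, N = m + 1 := ⟨N - 1, by omega⟩
    simp only [BandMatrix.chainIntegrand_succ]
    exact (BandMatrix.integral_pow_toLp_mul hk hg hb hgm hc hK m).symm
  refine ⟨BandMatrix.isProbabilityMeasure_law N hW, (BandMatrix.integral_band hW hC _ _).1, ?_,
    hchain, K, hg, fun u => ⟨Filter.Eventually.of_forall fun Q =>
      BandMatrix.integrable_kernel_mul hk hg hb (Lp.memLp u) Q, hK u⟩, hpair, ?_⟩
  · obtain ⟨m, rfl⟩ : ∃ m, N = m + 1 := ⟨N - 1, by omega⟩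
    simp only [funext (BandMatrix.chainIntegrand_succ m hN W z ζ)]
    exact BandMatrix.integrable_mul_pathWeight hk hg hb hgm m
  · intro him hre
    rw [hpair, L2.inner_def]
    refine integral_congr_ae ?_
    filter_upwards [hg.coeFn_toLp] with Q hQ
    -- The inner product conjugates its first argument `g`, which is real here.
    rw [hQ, RCLike.inner_apply, BandMatrix.conj_g him hre]
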